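/- **Proposition (Multimarginal PINN objective).** Let $N,d\in\mathbb N$ and let $D\subset\mathbb R^N$ be measurable, connected and nonempty, locally convex (every $\alpha\in D$ has a neighborhood $V$ with $V\cap D$ convex) and contained in the closure of its interior; for instance, $D$ is open and connected, or a Borel convex set with nonempty interior. Derivatives in $\alpha$ are taken within $D$. Let $\mathcal U:D\times\mathbb R^d\to\mathbb R$ be $C^2$ with $e^{-\mathcal U(\alpha,\cdot)}$ integrable for all $\alpha\in D$, and suppose that near each point of $D$ the first and second derivatives in $\alpha$ of $e^{-\mathcal U(\alpha,x)}$ are bounded in norm by an integrable function of $x$. Put $$\mathcal F(\alpha)=-\log\int_{\mathbb R^d}e^{-\mathcal U(\alpha,x)}\,dx,\qquad \varrho(\alpha,x)=e^{-\mathcal U(\alpha,x)+\mathcal F(\alpha)} .$$ Let $\hat\varrho(\alpha,x)>0$ be jointly measurable and a probability density in $x$ for every $\alpha\in D$, and let $f$ be a probability density on $D$ with full support (every neighborhood in $D$ of every point of $D$ has positive $f$-mass). Call a pair $(\hat{\mathcal B},\hat{\mathcal F})$ *admissible* if $\hat{\mathcal B}:D\times\mathbb R^d\to\mathbb R^{N\times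 d}$ is $C^1$ in $(\alpha,x)$, $\hat{\mathcal F}:D\to\mathbb R$ is $C^1$, and there is no flux at infinity: for all $\alpha\in D$ and $1\le i\le N$, $$\lim_{R\to\infty}\int_{|x|=R}\varrho(\alpha,x)\sum_{j=1}^d\hat{\mathcal B}_{ij}(\alpha,x)\frac{x_j}{|x|}\,dS(x)=0 .$$ For admissible pairs define, with $(\nabla_x\cdot\hat{\mathcal B})_i=\sum_j\partial_{x_j}\hat{\mathcal B}_{ij}$, $$L[\hat{\mathcal B},\hat{\mathcal F}]=\int_D\int_{\mathbb R^d}\Big|\nabla_x\cdot\hat{\mathcal B}-\hat{\mathcal B}\,\nabla_x\mathcal U-\nabla_\alpha\mathcal U+\nabla_\alpha\hat{\mathcal F}\Big|^2\hat\varrho(\alpha,x)f(\alpha)\,dx\,d\alpha\in[0,\infty].$$ Then the minimum of $L$ over admissible pairs is attained and equals $0$. Every minimizer $(\mathcal B,\hat{\mathcal F})$ satisfies $$\nabla_x\cdot\mathcal B-\mathcal B\,\nabla_x\mathcal U-\nabla_\alpha\mathcal U+\nabla_\alpha\hat{\mathcal F}=0\qquad\text{for all }(\alpha,x)\in D\times\mathbb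 R^d,$$ the same equation holds with the free energy $\mathcal F$ in place of $\hat{\mathcal F}$, and $\hat{\mathcal F}$ is the free energy up to an additive constant: $\hat{\mathcal F}=\mathcal F+c$ on $D$ for some $c\in\mathbb R$. In particular, if $\hat{\mathcal F}(\alpha_0)=\mathcal F(\alpha_0)$ for one $\alpha_0\in D$, then $\hat{\mathcal F}=\mathcal F$ on $D$. -/

import Mathlib

open MeasureTheory Set Filter Topology
open scoped RealInnerProductSpace Matrix

noncomputable section

namespace MultimarginalPINN

/-- The free energy `𝓕(α) = - log ∫ exp (-𝓤(α, x)) dx`. -/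
def freeEnergy {N d : ℕ} (U : EuclideanSpace ℝ (Fin N) → EuclideanSpace ℝ (Fin d) → ℝ)
    (α : EuclideanSpace ℝ (Fin N)) : ℝ :=
  -Real.log (∫ x, Real.exp (-U α x))

/-- The normalized density `ϱ(α, x) = exp (-𝓤(α, x) + 𝓕(α))`. -/
def density {N d : ℕ} (U : EuclideanSpace ℝ (Fin N) → EuclideanSpace ℝ (Fin d) → ℝ)
    (α : EuclideanSpace ℝ (Fin N)) (x : EuclideanSpace ℝ (Fin d)) : ℝ :=
  Real.exp (-U α x + freeEnergy U α)

/-- The row-wise divergence in `x` of a matrix field: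
`(∇ₓ · 𝓑)ᵢ = ∑ⱼ ∂𝓑ᵢⱼ / ∂xⱼ`. -/
def rowDiv {N d : ℕ}
    (B : EuclideanSpace ℝ (Fin N) → EuclideanSpace ℝ (Fin d) → Matrix (Fin N) (Fin d) ℝ)
    (α : EuclideanSpace ℝ (Fin N)) (x : EuclideanSpace ℝ (Fin d)) (i : Fin N) : ℝ :=
  ∑ j : Fin d, fderiv ℝ (fun y => B α y i j) x (EuclideanSpace.single j 1)

/-- The residual `∇ₓ · 𝓑 - 𝓑 ∇ₓ𝓤 - ∇_α 𝓤 + ∇_α F`, a vector of `ℝᴺ`.  Gradients in `α` are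
taken within `D`, so that `D` may contain some of its boundary points. -/
def residual {N d : ℕ} (D : Set (EuclideanSpace ℝ (Fin N)))
    (U : EuclideanSpace ℝ (Fin N) → EuclideanSpace ℝ (Fin d) → ℝ)
    (B : EuclideanSpace ℝ (Fin N) → EuclideanSpace ℝ (Fin d) → Matrix (Fin N) (Fin d) ℝ)
    (F : EuclideanSpace ℝ (Fin N) → ℝ)
    (α : EuclideanSpace ℝ (Fin N)) (x : EuclideanSpace ℝ (Fin d)) :
    EuclideanSpace ℝ (Fin N) :=
  WithLp.toLp 2 (fun i =>
    rowDiv B α x i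
      - (B α x *ᵥ (fun j => gradient (fun y => U α y) x j)) i
      - gradientWithin (fun a => U a x) D α i
      + gradientWithin F D α i)

/-- The multimarginal PINN loss, with values in `[0, ∞]`. -/
def pinnLoss {N d : ℕ} (D : Set (EuclideanSpace ℝ (Fin N)))
    (U : EuclideanSpace ℝ (Fin N) → EuclideanSpace ℝ (Fin d) → ℝ)
    (q : EuclideanSpace ℝ (Fin N) → EuclideanSpace ℝ (Fin d) → ℝ)
    (f : EuclideanSpace ℝ (Fin N) → ℝ)
    (B : EuclideanSpace ℝ (Fin N) → EuclideanSpace ℝ (Fin d) → Matrix (Fin N) (Fin d) ℝ)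
    (F : EuclideanSpace ℝ (Fin N) → ℝ) : ENNReal :=
  ∫⁻ α in D, ∫⁻ x, ENNReal.ofReal (‖residual D U B F α x‖ ^ 2 * q α x * f α)

/-- The outward flux of the `i`-th row of `𝓑(α, ·) ϱ(α, ·)` through the sphere of radius `R`
centred at the origin; `volume.toSphere` is the surface measure of the unit sphere. -/
def sphereFlux {N d : ℕ}
    (U : EuclideanSpace ℝ (Fin N) → EuclideanSpace ℝ (Fin d) → ℝ)
    (B : EuclideanSpace ℝ (Fin N) → EuclideanSpace ℝ (Fin d) → Matrix (Fin N) (Fin d) ℝ)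
    (α : EuclideanSpace ℝ (Fin N)) (i : Fin N) (R : ℝ) : ℝ :=
  R ^ (d - 1) *
    ∫ θ : Metric.sphere (0 : EuclideanSpace ℝ (Fin d)) 1,
      (∑ j : Fin d, B α (R • (θ : EuclideanSpace ℝ (Fin d))) i j
          * (θ : EuclideanSpace ℝ (Fin d)) j)
        * density U α (R • (θ : EuclideanSpace ℝ (Fin d)))
      ∂((volume : Measure (EuclideanSpace ℝ (Fin d))).toSphere)

/-- The pairs `(𝓑, F)` over which the loss is minimized: both continuously differentiable, and
`𝓑(α, ·) ϱ(α, ·)` has no flux through infinity. -/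
def Admissible {N d : ℕ} (D : Set (EuclideanSpace ℝ (Fin N)))
    (U : EuclideanSpace ℝ (Fin N) → EuclideanSpace ℝ (Fin d) → ℝ) :
    Set ((EuclideanSpace ℝ (Fin N) → EuclideanSpace ℝ (Fin d) → Matrix (Fin N) (Fin d) ℝ)
      × (EuclideanSpace ℝ (Fin N) → ℝ)) :=
  {p | (∀ i j, ContDiffOn ℝ 1
          (fun z : EuclideanSpace ℝ (Fin N) × EuclideanSpace ℝ (Fin d) => p.1 z.1 z.2 i j)
          (D ×ˢ univ)) ∧
       ContDiffOn ℝ 1 p.2 D ∧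
       ∀ α ∈ D, ∀ i, Tendsto (sphereFlux U p.1 α i) atTop (𝓝 0)}

/-- Local domination: near every point of `D`, the first and second derivatives in `α` of
`exp (-𝓤(α, x))` are bounded by an integrable function of `x`. -/
def LocallyDominated {N d : ℕ} (D : Set (EuclideanSpace ℝ (Fin N)))
    (U : EuclideanSpace ℝ (Fin N) → EuclideanSpace ℝ (Fin d) → ℝ) : Prop :=
  ∀ α₀ ∈ D, ∃ V ∈ 𝓝 α₀, ∃ g : EuclideanSpace ℝ (Fin d) → ℝ, Integrable g ∧
    ∀ α ∈ V ∩ D, ∀ x, ∀ k ∈ Finset.Icc 1 2,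
      ‖iteratedFDerivWithin ℝ k (fun a => Real.exp (-U a x)) D α‖ ≤ g x

end MultimarginalPINN

end

namespace MultimarginalPINN

/-! Multiplied by `ϱ > 0`, the `i`-th residual becomes `div (ϱ 𝓑ᵢ) - ϱ (∂ᵢ𝓤 - ∂ᵢF)`
(`density_mul_residual`). Differentiating under the integral gives `∫ ϱ ∂ᵢ𝓤 = ∂ᵢ𝓕`, so the second
term has integral `∂ᵢ𝓕 - ∂ᵢF` (`integral_source_freeEnergy`). Everything rests on this compatibility
condition.

Existence: for `F = 𝓕` the right-hand side `k` of `div (ϱ 𝓑ᵢ) = k` has mean zero. The field `x ∫₀¹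
t^(d-1) k(t x) dt` has divergence `k` by an Euler identity, and its flux through the sphere of
radius `R` is the integral of `k` over the ball, which tends to `∫ k = 0`. Division by `ϱ` gives
`radialField`, an admissible field with zero residual. It is `C¹` in `α` only if `∇𝓕` is, hence the
need for domination of second derivatives.

Uniqueness: the minimum is therefore `0`. A continuous residual with zero loss vanishes everywhere,
because `q` is positive and `f` has full support. Then `div (ϱ 𝓑ᵢ)` equals an integrable source, and
the absence of flux at infinity makes its integral zero (`integral_div_eq_zero_of_tendsto_flux`).
Hence `∇F = ∇𝓕`, and connectedness with local convexity makes `F - 𝓕` constant. -/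

theorem exists_nhds_bound_of_continuousOn_prod {E Y F : Type*} [TopologicalSpace E] [TopologicalSpace Y]
    [NormedAddCommGroup F] {s : Set E} {K : Set Y} (hK : IsCompact K)
    {ψ : E → Y → F} (hc : ContinuousOn (fun p : E × Y => ψ p.1 p.2) (s ×ˢ K))
    {z₀ : E} (hz₀ : z₀ ∈ s) :
    ∃ V ∈ 𝓝 z₀, ∃ C : ℝ, ∀ z ∈ V ∩ s, ∀ t ∈ K, ‖ψ z t‖ ≤ C := by
  have h0 : ContinuousOn (ψ z₀) K :=
    hc.comp (f := fun t => (z₀, t)) (by fun_prop) fun t ht => ⟨hz₀, ht⟩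
  obtain ⟨C, hC⟩ := hK.exists_bound_of_continuousOn h0
  have := hK.eventually_forall_of_forall_eventually (x₀ := z₀)
    (P := fun z t => z ∈ s → t ∈ K → ‖ψ z t‖ ≤ C + 1) fun t ht => by
      have h1 : ContinuousWithinAt (fun p : E × Y => ‖ψ p.1 p.2‖) (s ×ˢ K) (z₀, t) :=
        (hc _ ⟨hz₀, ht⟩).norm
      have h2 := h1.eventually_lt_const (u := C + 1)
        (by simpa using (hC t ht).trans_lt (lt_add_one C))
      rw [eventually_nhdsWithin_iff] at h2
      filter_upwards [h2] with p hp h3 h4 using (hp ⟨h3, h4⟩).le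
  exact ⟨_, this, C + 1, fun z hz t ht => hz.1 t ht hz.2 ht⟩

/-! ### Differentiation under the integral sign within a locally convex set. -/

section Parametric

variable {E G X : Type*} [NormedAddCommGroup E] [NormedSpace ℝ E]
  [NormedAddCommGroup G] [NormedSpace ℝ G] [MeasurableSpace X] {μ : Measure X}

/-- Every point of `s` has a neighbourhood whose trace on `s` is convex. -/
def LocConvex (s : Set E) : Prop := ∀ z ∈ s, ∃ V ∈ 𝓝 z, Convex ℝ (V ∩ s)

/-- A convex set with nonempty interior has unique derivatives at points of its closure. The convex
trace near `z` has interior points because `z` is a limit of interior points of `s`. -/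
theorem LocConvex.uniqueDiffOn {s : Set E} (hs : LocConvex s) (hi : s ⊆ closure (interior s)) :
    UniqueDiffOn ℝ s := by
  intro z hz
  obtain ⟨V, hV, hc⟩ := hs z hz
  have hne : (interior (V ∩ s)).Nonempty := by
    rw [interior_inter]
    exact mem_closure_iff.1 (hi hz) _ isOpen_interior (mem_interior_iff_mem_nhds.2 hV)
  have := uniqueDiffWithinAt_convex hc hne (subset_closure ⟨mem_of_mem_nhds hV, hz⟩)
  exact this.mono inter_subset_right

theorem LocConvex.prod_univ {s : Set E} (hs : LocConvex s) :
    LocConvex (s ×ˢ (univ : Set G)) := by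
  rintro ⟨z, x⟩ ⟨hz, -⟩
  obtain ⟨V, hV, hc⟩ := hs z hz
  refine ⟨V ×ˢ univ, prod_mem_nhds hV univ_mem, ?_⟩
  rw [prod_inter_prod, univ_inter]
  exact hc.prod convex_univ

theorem locConvex_univ : LocConvex (univ : Set E) :=
  fun _ _ => ⟨univ, univ_mem, by simpa using convex_univ⟩

/-- Differentiation under the integral sign within a locally convex set. -/
theorem LocConvex.hasFDerivWithinAt_integral [CompleteSpace G] {s : Set E} (hs : LocConvex s)
    {φ : E → X → G} {φ' : E → X → E →L[ℝ] G} {z₀ : E} (hz₀ : z₀ ∈ s)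
    (hφ : ∀ z ∈ s, Integrable (φ z) μ) (hφ' : AEStronglyMeasurable (φ' z₀) μ)
    {V : Set E} (hV : V ∈ 𝓝 z₀) {g : X → ℝ} (hg : Integrable g μ)
    (hb : ∀ᵐ t ∂μ, ∀ z ∈ V ∩ s, ‖φ' z t‖ ≤ g t)
    (hd : ∀ᵐ t ∂μ, ∀ z ∈ s, HasFDerivWithinAt (φ · t) (φ' z t) s z) :
    HasFDerivWithinAt (fun z => ∫ t, φ z t ∂μ) (∫ t, φ' z₀ t ∂μ) s z₀ := by
  obtain ⟨W, hW, hc⟩ := hs z₀ hz₀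
  have hI : Integrable (φ' z₀) μ :=
    hg.mono' hφ' (hb.mono fun t ht => ht z₀ ⟨mem_of_mem_nhds hV, hz₀⟩)
  obtain ⟨r, hr, hrV⟩ := Metric.mem_nhds_iff.1 hV
  set C : Set E := Metric.ball z₀ r ∩ (W ∩ s) with hC
  have hCc : Convex ℝ C := (convex_ball z₀ r).inter hc
  have hCs : C ⊆ s := fun z hz => hz.2.2
  have hCV : C ⊆ V ∩ s := fun z hz => ⟨hrV hz.1, hz.2.2⟩
  have hz₀C : z₀ ∈ C := ⟨Metric.mem_ball_self hr, mem_of_mem_nhds hW, hz₀⟩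
  have hCn : C ∈ 𝓝[s] z₀ := by
    refine inter_mem (mem_nhdsWithin_of_mem_nhds (Metric.ball_mem_nhds _ hr)) ?_
    exact inter_mem (mem_nhdsWithin_of_mem_nhds hW) self_mem_nhdsWithin
  rw [hasFDerivWithinAt_iff_tendsto]
  -- Dominated convergence for the normalized remainder. On the convex set `C` the derivative
  -- differs from `φ' z₀ t` by at most `2 * g t`, so the mean value inequality bounds the quotient
  -- by `2 * g t`.
  have key : Tendsto (fun z => ∫ t, ‖z - z₀‖⁻¹ * ‖φ z t - φ z₀ t - φ' z₀ t (z - z₀)‖ ∂μ)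
      (𝓝[s] z₀) (𝓝 (∫ _, (0 : ℝ) ∂μ)) := by
    refine tendsto_integral_filter_of_dominated_convergence (fun t => 2 * g t) ?_ ?_
      (hg.const_mul 2) ?_
    · filter_upwards [hCn] with z hz
      exact ((((hφ z (hCs hz)).sub (hφ z₀ hz₀)).sub
        (hI.apply_continuousLinearMap (z - z₀))).norm.const_mul _).aestronglyMeasurable
    · filter_upwards [hCn] with z hz
      filter_upwards [hb, hd] with t hbt hdt
      have hg0 : 0 ≤ g t := (norm_nonneg _).trans (hbt z₀ (hCV hz₀C))
      have := hCc.norm_image_sub_le_of_norm_hasFDerivWithin_le' (f := (φ · t))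
        (f' := fun z => φ' z t) (φ := φ' z₀ t) (C := 2 * g t)
        (fun w hw => (hdt w (hCs hw)).mono hCs) (fun w hw => by
          have h1 := norm_sub_le (φ' w t) (φ' z₀ t)
          have h2 := hbt w (hCV hw)
          have h3 := hbt z₀ (hCV hz₀C)
          linarith) hz₀C hz
      rw [norm_mul, norm_inv, norm_norm, norm_norm]
      -- At `z = z₀` the quotient is `0`, by the convention `0⁻¹ = 0`.
      rcases eq_or_ne (‖z - z₀‖) 0 with h0 | h0
      · rw [h0]; simp [hg0]
      · rw [inv_mul_le_iff₀ (lt_of_le_of_ne (norm_nonneg _) h0.symm)]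
        linarith
    · filter_upwards [hd] with t hdt
      exact hasFDerivWithinAt_iff_tendsto.1 (hdt z₀ hz₀)
  rw [integral_zero] at key
  refine squeeze_zero' (Eventually.of_forall fun z => by positivity) ?_ key
  filter_upwards [hCn] with z hz
  have e : (∫ t, φ z t ∂μ) - (∫ t, φ z₀ t ∂μ) - (∫ t, φ' z₀ t ∂μ) (z - z₀)
      = ∫ t, (φ z t - φ z₀ t - φ' z₀ t (z - z₀)) ∂μ := by
    rw [ContinuousLinearMap.integral_apply hI, ← integral_sub (hφ z (hCs hz)) (hφ z₀ hz₀)]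
    exact (integral_sub ((hφ z (hCs hz)).sub (hφ z₀ hz₀)) (hI.apply_continuousLinearMap _)).symm
  rw [e, integral_const_mul]
  gcongr
  exact norm_integral_le_integral_norm _

theorem contDiffOn_one_of_hasFDerivWithinAt {s : Set E} (hu : UniqueDiffOn ℝ s)
    {F : E → G} {F' : E → E →L[ℝ] G} (hd : ∀ z ∈ s, HasFDerivWithinAt F (F' z) s z)
    (hc : ContinuousOn F' s) : ContDiffOn ℝ 1 F s := by
  rw [show (1 : WithTop ℕ∞) = 0 + 1 from rfl,
    contDiffOn_succ_iff_hasFDerivWithinAt_of_uniqueDiffOn hu]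
  exact ⟨by simp, F', contDiffOn_zero.2 hc, hd⟩

/-- A parametric integral whose derivative is locally dominated is continuously differentiable
within a locally convex set. -/
theorem LocConvex.contDiffOn_integral [CompleteSpace G] {s : Set E} (hs : LocConvex s)
    (hu : UniqueDiffOn ℝ s) {φ : E → X → G} {φ' : E → X → E →L[ℝ] G}
    (hφ : ∀ z ∈ s, Integrable (φ z) μ) (hφ' : ∀ z ∈ s, AEStronglyMeasurable (φ' z) μ)
    (hb : ∀ z₀ ∈ s, ∃ V ∈ 𝓝 z₀, ∃ g : X → ℝ, Integrable g μ ∧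
      ∀ᵐ t ∂μ, ∀ z ∈ V ∩ s, ‖φ' z t‖ ≤ g t)
    (hd : ∀ᵐ t ∂μ, ∀ z ∈ s, HasFDerivWithinAt (φ · t) (φ' z t) s z)
    (hc : ∀ᵐ t ∂μ, ContinuousOn (φ' · t) s) :
    (∀ z ∈ s, HasFDerivWithinAt (fun z => ∫ t, φ z t ∂μ) (∫ t, φ' z t ∂μ) s z) ∧
    ContDiffOn ℝ 1 (fun z => ∫ t, φ z t ∂μ) s := by
  have h1 : ∀ z ∈ s, HasFDerivWithinAt (fun z => ∫ t, φ z t ∂μ) (∫ t, φ' z t ∂μ) s z := by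
    intro z hz
    obtain ⟨V, hV, g, hg, hbg⟩ := hb z hz
    exact hs.hasFDerivWithinAt_integral hz hφ (hφ' z hz) hV hg hbg hd
  refine ⟨h1, contDiffOn_one_of_hasFDerivWithinAt hu h1 fun z hz => ?_⟩
  obtain ⟨V, hV, g, hg, hbg⟩ := hb z hz
  refine continuousWithinAt_of_dominated (bound := g) ?_ ?_ hg ?_
  · filter_upwards [self_mem_nhdsWithin] with w hw using hφ' w hw
  · filter_upwards [self_mem_nhdsWithin, mem_nhdsWithin_of_mem_nhds hV] with w hw hwV
    filter_upwards [hbg] with t ht using ht w ⟨hwV, hw⟩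
  · filter_upwards [hc] with t ht using ht z hz

/-- Parametric integrals over `[0, 1]` of jointly continuous families. -/
theorem LocConvex.contDiffOn_intervalIntegral [CompleteSpace G] {s : Set E} (hs : LocConvex s)
    (hu : UniqueDiffOn ℝ s) {ψ : E → ℝ → G} {ψ' : E → ℝ → E →L[ℝ] G}
    (hψ : ∀ z ∈ s, ContinuousOn (ψ z) (Icc 0 1))
    (hψ' : ContinuousOn (fun p : E × ℝ => ψ' p.1 p.2) (s ×ˢ Icc 0 1))
    (hd : ∀ t ∈ Icc (0 : ℝ) 1, ∀ z ∈ s, HasFDerivWithinAt (ψ · t) (ψ' z t) s z) :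
    (∀ z ∈ s, HasFDerivWithinAt (fun z => ∫ t in (0 : ℝ)..1, ψ z t)
      (∫ t in (0 : ℝ)..1, ψ' z t) s z) ∧
    ContDiffOn ℝ 1 (fun z => ∫ t in (0 : ℝ)..1, ψ z t) s := by
  simp only [intervalIntegral.integral_of_le zero_le_one, ← integral_Icc_eq_integral_Ioc]
  refine hs.contDiffOn_integral hu ?_ ?_ ?_ ?_ ?_
  · exact fun z hz => (hψ z hz).integrableOn_Icc
  · exact fun z hz => ContinuousOn.aestronglyMeasurable
      (hψ'.comp (f := fun t => (z, t)) (by fun_prop) fun t ht => ⟨hz, ht⟩) measurableSet_Icc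
  · intro z₀ hz₀
    obtain ⟨V, hV, C, hC⟩ := exists_nhds_bound_of_continuousOn_prod isCompact_Icc hψ' hz₀
    refine ⟨V, hV, fun _ => C, integrable_const _, ?_⟩
    filter_upwards [ae_restrict_mem measurableSet_Icc] with t ht z hz using hC z hz t ht
  · filter_upwards [ae_restrict_mem measurableSet_Icc] with t ht using hd t ht
  · filter_upwards [ae_restrict_mem measurableSet_Icc] with t ht
    exact hψ'.comp (f := fun z => (z, t)) (by fun_prop) fun z hz => ⟨hz, ht⟩

end Parametric

/-! ### Radial means and the Euler identity. -/

section Radial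

variable {A E : Type*} [NormedAddCommGroup A] [NormedSpace ℝ A]
  [NormedAddCommGroup E] [NormedSpace ℝ E]

/-- The weighted mean of `h` along the segment from the origin to `x`. -/
noncomputable def radialMean (n : ℕ) (h : E → ℝ) (x : E) : ℝ :=
  ∫ t in (0 : ℝ)..1, t ^ n * h (t • x)

/-- The integrand is the joint function pulled back along the linear maps `L t : (α, x) ↦ (α, t •
x)`, which preserve `D ×ˢ univ` and depend continuously on `t`. The chain rule then gives a jointly
continuous derivative. -/
theorem contDiffOn_radialMean {D : Set A} (hD : LocConvex D) (hu : UniqueDiffOn ℝ D) (n : ℕ)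
    {k : A → E → ℝ} (hk : ContDiffOn ℝ 1 (fun z : A × E => k z.1 z.2) (D ×ˢ univ)) :
    ContDiffOn ℝ 1 (fun z : A × E => radialMean n (k z.1) z.2) (D ×ˢ univ) := by
  set K : A × E → ℝ := fun z => k z.1 z.2 with hK
  have hu' : UniqueDiffOn ℝ (D ×ˢ (univ : Set E)) := hu.prod uniqueDiffOn_univ
  set L : ℝ → A × E →L[ℝ] A × E := fun t =>
    (ContinuousLinearMap.fst ℝ A E).prod (t • ContinuousLinearMap.snd ℝ A E) with hL
  have hLc : Continuous L := by
    have : L = fun t => (ContinuousLinearMap.inl ℝ A E).comp (ContinuousLinearMap.fst ℝ A E)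
        + t • (ContinuousLinearMap.inr ℝ A E).comp (ContinuousLinearMap.snd ℝ A E) := by
      ext t z <;> simp [hL]
    rw [this]; fun_prop
  refine (hD.prod_univ.contDiffOn_intervalIntegral hu'
    (ψ := fun z t => t ^ n * K (L t z))
    (ψ' := fun z t => t ^ n • (fderivWithin ℝ K (D ×ˢ univ) (L t z)).comp (L t)) ?_ ?_ ?_).2
  · intro z hz
    refine ContinuousOn.mul (by fun_prop) (hk.continuousOn.comp (by fun_prop) ?_)
    exact fun t _ => ⟨hz.1, mem_univ _⟩
  · have h1 : ContinuousOn (fun p : (A × E) × ℝ =>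
        fderivWithin ℝ K (D ×ˢ univ) (L p.2 p.1)) ((D ×ˢ univ) ×ˢ Icc 0 1) := by
      refine (hk.continuousOn_fderivWithin hu' le_rfl).comp ?_ fun p hp => ⟨hp.1.1, mem_univ _⟩
      exact ((hLc.comp continuous_snd).clm_apply continuous_fst).continuousOn
    have h2 : ContinuousOn (fun p : (A × E) × ℝ => L p.2) ((D ×ˢ univ) ×ˢ Icc 0 1) :=
      (hLc.comp continuous_snd).continuousOn
    have h3 : Continuous fun p : (A × E) × ℝ => p.2 ^ n := by fun_prop
    exact h3.continuousOn.smul (h1.clm_comp h2)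
  · intro t _ z hz
    have h1 : HasFDerivWithinAt K (fderivWithin ℝ K (D ×ˢ univ) (L t z)) (D ×ˢ univ) (L t z) :=
      (hk.differentiableOn one_ne_zero (L t z) ⟨hz.1, mem_univ _⟩).hasFDerivWithinAt
    exact (h1.comp z (L t).hasFDerivWithinAt fun w hw => ⟨hw.1, mem_univ _⟩).const_mul _

theorem hasFDerivAt_radialMean (n : ℕ) {h : E → ℝ} (hh : ContDiff ℝ 1 h) (x : E) :
    HasFDerivAt (radialMean n h) (∫ t in (0 : ℝ)..1, (t ^ n * t) • fderiv ℝ h (t • x)) x := by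
  have hf : Continuous (fderiv ℝ h) := hh.continuous_fderiv one_ne_zero
  have hc := hh.continuous
  have := (locConvex_univ.contDiffOn_intervalIntegral uniqueDiffOn_univ
    (ψ := fun z t => t ^ n * h (t • z))
    (ψ' := fun z t => (t ^ n * t) • fderiv ℝ h (t • z)) ?_ ?_ ?_).1 x (mem_univ x)
  · rwa [hasFDerivWithinAt_univ] at this
  · exact fun z _ => by fun_prop
  · exact Continuous.continuousOn (by fun_prop)
  · intro t _ z _
    rw [hasFDerivWithinAt_univ, mul_smul]
    have h1 : HasFDerivAt h (fderiv ℝ h (t • z)) (t • z) :=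
      (hh.differentiable one_ne_zero _).hasFDerivAt
    have h2 : HasFDerivAt (fun z : E => t • z) (t • ContinuousLinearMap.id ℝ E) z :=
      (hasFDerivAt_id z).const_smul t
    have := (h1.comp z h2).const_mul (t ^ n)
    simpa using this

/-- Euler-type identity for the radial mean, from the fundamental theorem of calculus. -/
theorem radialMean_add_fderiv (n : ℕ) {h : E → ℝ} (hh : ContDiff ℝ 1 h) (x : E) :
    (n + 1 : ℝ) * radialMean n h x + fderiv ℝ (radialMean n h) x x = h x := by
  have hf : Continuous (fderiv ℝ h) := hh.continuous_fderiv one_ne_zero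
  have hc := hh.continuous
  have hi : IntervalIntegrable (fun t : ℝ => (t ^ n * t) • fderiv ℝ h (t • x)) volume 0 1 :=
    Continuous.intervalIntegrable (by fun_prop) _ _
  rw [(hasFDerivAt_radialMean n hh x).fderiv, ContinuousLinearMap.intervalIntegral_apply hi,
    radialMean, ← intervalIntegral.integral_const_mul, ← intervalIntegral.integral_add
      (Continuous.intervalIntegrable (by fun_prop) _ _)
      (Continuous.intervalIntegrable (by fun_prop) _ _)]
  -- The two integrands on the left add up to this exact derivative. The exponent `n + 1` is
  -- positive, so the boundary term at `t = 0` vanishes and only `h x` remains.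
  have hd : ∀ t : ℝ, HasDerivAt (fun t : ℝ => t ^ (n + 1) * h (t • x))
      ((n + 1 : ℝ) * (t ^ n * h (t • x)) + ((t ^ n * t) • fderiv ℝ h (t • x)) x) t := by
    intro t
    have h1 : HasFDerivAt h (fderiv ℝ h (t • x)) (t • x) :=
      (hh.differentiable one_ne_zero _).hasFDerivAt
    have h2 : HasDerivAt (fun t : ℝ => t • x) x t := by
      simpa using (hasDerivAt_id t).smul_const x
    have := (hasDerivAt_pow (n + 1) t).mul (h1.comp_hasDerivAt t h2)
    refine this.congr_deriv ?_
    simp [pow_succ]; ring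
  rw [intervalIntegral.integral_eq_sub_of_hasDerivAt (fun t _ => hd t)
    (Continuous.intervalIntegrable (by fun_prop) _ _)]
  simp

/-- Substitution `r = t * R`. With `n = d - 1` the right side is the radial integral of polar
coordinates. Of the power `R ^ (n + 1)`, `R ^ n` is the surface factor and one `R` comes from the
field `x = R • θ`. -/
theorem pow_mul_radialMean (n : ℕ) (h : E → ℝ) (θ : E) (R : ℝ) :
    R ^ (n + 1) * radialMean n h (R • θ) = ∫ r in (0 : ℝ)..R, r ^ n * h (r • θ) := by
  have := intervalIntegral.smul_integral_comp_mul_right (a := 0) (b := 1)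
    (fun r => r ^ n * h (r • θ)) R
  simp only [zero_mul, one_mul, smul_eq_mul] at this
  rw [← this, radialMean, pow_succ', mul_assoc, ← intervalIntegral.integral_const_mul]
  congr 1
  refine intervalIntegral.integral_congr fun t _ => ?_
  simp [mul_pow, smul_smul]; ring

end Radial

/-! ### Polar coordinates and the flux of a radial field. -/

section Polar

variable {E : Type*} [NormedAddCommGroup E] [NormedSpace ℝ E] [MeasurableSpace E] [BorelSpace E]
  [FiniteDimensional ℝ E] (μ : Measure E) [μ.IsAddHaarMeasure]

theorem integral_volumeIoiPow (n : ℕ) (f : ℝ → ℝ) :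
    ∫ r : Ioi (0 : ℝ), f r ∂Measure.volumeIoiPow n = ∫ r in Ioi (0 : ℝ), r ^ n * f r := by
  simp only [Measure.volumeIoiPow, ENNReal.ofReal]
  rw [integral_withDensity_eq_integral_smul,
    integral_subtype_comap measurableSet_Ioi fun a ↦ Real.toNNReal (a ^ n) • f a,
    setIntegral_congr_fun measurableSet_Ioi fun x hx ↦ ?_]
  · rw [NNReal.smul_def, Real.coe_toNNReal _ (pow_nonneg (le_of_lt hx) _), smul_eq_mul]
  · exact (measurable_subtype_coe.pow_const _).real_toNNReal

theorem integrable_polar_prod {f : E → ℝ} (hf : Integrable f μ) :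
    Integrable (fun p : Metric.sphere (0 : E) 1 × Ioi (0 : ℝ) => f ((p.2 : ℝ) • (p.1 : E)))
      (μ.toSphere.prod (.volumeIoiPow (Module.finrank ℝ E - 1))) := by
  rw [← μ.measurePreserving_homeomorphUnitSphereProd.integrable_comp_emb
        (Homeomorph.measurableEmbedding _)]
  have h1 : Integrable (fun x : ({(0)}ᶜ : Set E) => f x.1) (μ.comap (↑)) := by
    have := (integrableOn_iff_comap_subtypeVal (μ := μ) (f := f)
      (measurableSet_singleton (0 : E)).compl).1 hf.integrableOn
    exact this
  refine h1.congr (.of_forall fun x => ?_)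
  have hx : ‖(x : E)‖ ≠ 0 := norm_ne_zero_iff.2 x.2
  simp [smul_smul, hx]

variable [Nontrivial E]

theorem integral_eq_integral_polar_prod (f : E → ℝ) :
    ∫ x, f x ∂μ = ∫ p : Metric.sphere (0 : E) 1 × Ioi (0 : ℝ), f ((p.2 : ℝ) • (p.1 : E))
      ∂μ.toSphere.prod (.volumeIoiPow (Module.finrank ℝ E - 1)) := by
  calc ∫ x, f x ∂μ = ∫ x : ({(0)}ᶜ : Set E), f x.1 ∂(μ.comap (↑)) := by
        rw [integral_subtype_comap (measurableSet_singleton _).compl fun x ↦ f x,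
          restrict_compl_singleton]
    _ = _ := by
      rw [← μ.measurePreserving_homeomorphUnitSphereProd.integral_comp
        (Homeomorph.measurableEmbedding _)]
      refine integral_congr_ae (.of_forall fun x => ?_)
      have hx : ‖(x : E)‖ ≠ 0 := norm_ne_zero_iff.2 x.2
      simp [smul_smul, hx]

/-- Integration in polar coordinates, the sphere outside. -/
theorem integral_eq_integral_sphere_integral_Ioi {f : E → ℝ} (hf : Integrable f μ) :
    ∫ x, f x ∂μ = ∫ θ : Metric.sphere (0 : E) 1, ∫ r in Ioi (0 : ℝ),
      r ^ (Module.finrank ℝ E - 1) * f (r • (θ : E)) ∂volume ∂μ.toSphere := by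
  rw [integral_eq_integral_polar_prod, integral_prod _ (integrable_polar_prod μ hf)]
  refine integral_congr_ae (.of_forall fun θ => ?_)
  exact integral_volumeIoiPow _ fun r => f (r • (θ : E))

/-- Integration in polar coordinates, the radius outside. -/
theorem integral_eq_integral_Ioi_integral_sphere {f : E → ℝ} (hf : Integrable f μ) :
    ∫ x, f x ∂μ = ∫ r in Ioi (0 : ℝ), r ^ (Module.finrank ℝ E - 1) *
      ∫ θ : Metric.sphere (0 : E) 1, f (r • (θ : E)) ∂μ.toSphere := by
  rw [integral_eq_integral_polar_prod, integral_prod_symm _ (integrable_polar_prod μ hf)]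
  exact integral_volumeIoiPow _ fun r => ∫ θ : Metric.sphere (0 : E) 1, f (r • (θ : E)) ∂μ.toSphere

/-- The flux of the radial field `x ↦ radialMean h x • x` is the integral of `h` over a ball. -/
theorem integral_sphere_radialMean {h : E → ℝ} (hf : Integrable h μ) {R : ℝ} (hR : 0 ≤ R) :
    ∫ θ : Metric.sphere (0 : E) 1, R ^ (Module.finrank ℝ E - 1 + 1) *
      radialMean (Module.finrank ℝ E - 1) h (R • (θ : E)) ∂μ.toSphere
      = ∫ x in Metric.closedBall (0 : E) R, h x ∂μ := by
  rw [← integral_indicator Metric.isClosed_closedBall.measurableSet,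
    integral_eq_integral_sphere_integral_Ioi μ
      (hf.indicator Metric.isClosed_closedBall.measurableSet)]
  refine integral_congr_ae (.of_forall fun θ => ?_)
  have hθ : ‖(θ : E)‖ = 1 := by simp
  simp only
  rw [pow_mul_radialMean, intervalIntegral.integral_of_le hR,
    ← Ioi_inter_Iic, ← setIntegral_indicator measurableSet_Iic,
    setIntegral_congr_fun measurableSet_Ioi fun r hr => ?_]
  have : ‖r • (θ : E)‖ = r := by rw [norm_smul, hθ, mul_one, Real.norm_of_nonneg (le_of_lt hr)]
  by_cases h2 : r ≤ R <;> simp [indicator, h2, this]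

end Polar

/-! ### Smooth radial cutoffs. -/

section Cutoff

/-- A smooth function on the line equal to `1` on `(-∞, 1]` and to `0` on `[2, ∞)`. -/
noncomputable def lineCutoff (s : ℝ) : ℝ := Real.smoothTransition (2 - s)

theorem contDiff_lineCutoff : ContDiff ℝ 1 lineCutoff :=
  Real.smoothTransition.contDiff.comp (contDiff_const.sub contDiff_id)

theorem lineCutoff_of_le {s : ℝ} (h : s ≤ 1) : lineCutoff s = 1 :=
  Real.smoothTransition.one_of_one_le (by linarith)

theorem lineCutoff_of_ge {s : ℝ} (h : 2 ≤ s) : lineCutoff s = 0 :=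
  Real.smoothTransition.zero_of_nonpos (by linarith)

theorem abs_lineCutoff_le (s : ℝ) : |lineCutoff s| ≤ 1 := by
  rw [lineCutoff, abs_of_nonneg (Real.smoothTransition.nonneg _)]
  exact Real.smoothTransition.le_one _

theorem deriv_lineCutoff_of_lt {s : ℝ} (h : s < 1) : deriv lineCutoff s = 0 := by
  have : lineCutoff =ᶠ[𝓝 s] fun _ => 1 :=
    (eventually_lt_nhds h).mono fun t ht => lineCutoff_of_le ht.le
  rw [this.deriv_eq, deriv_const]

theorem deriv_lineCutoff_of_gt {s : ℝ} (h : 2 < s) : deriv lineCutoff s = 0 := by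
  have : lineCutoff =ᶠ[𝓝 s] fun _ => 0 :=
    (eventually_gt_nhds h).mono fun t ht => lineCutoff_of_ge ht.le
  rw [this.deriv_eq, deriv_const]

variable {E : Type*} [NormedAddCommGroup E]

/-- A cutoff equal to `1` on the ball of radius `R` and to `0` outside the ball of radius `2R`. -/
noncomputable def ballCutoff (R : ℝ) (x : E) : ℝ := lineCutoff (‖x‖ ^ 2 / R ^ 2)

theorem hasCompactSupport_ballCutoff [ProperSpace E] {R : ℝ} (hR : 0 < R) :
    HasCompactSupport (ballCutoff R : E → ℝ) := by
  refine HasCompactSupport.intro (isCompact_closedBall 0 (2 * R)) fun x hx => ?_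
  have hx : 2 * R < ‖x‖ := by simpa using hx
  refine lineCutoff_of_ge ?_
  rw [le_div_iff₀ (by positivity)]
  nlinarith

end Cutoff

section Cutoff

variable {E : Type*} [NormedAddCommGroup E] [InnerProductSpace ℝ E]

theorem contDiff_ballCutoff (R : ℝ) : ContDiff ℝ 1 (ballCutoff R : E → ℝ) :=
  contDiff_lineCutoff.comp ((contDiff_norm_sq ℝ).div_const _)

theorem fderiv_ballCutoff (R : ℝ) (x v : E) :
    fderiv ℝ (ballCutoff R) x v
      = deriv lineCutoff (‖x‖ ^ 2 / R ^ 2) * (2 / R ^ 2) * ⟪x, v⟫ := by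
  have h1 : HasDerivAt lineCutoff (deriv lineCutoff (‖x‖ ^ 2 / R ^ 2)) (‖x‖ ^ 2 / R ^ 2) :=
    (contDiff_lineCutoff.differentiable one_ne_zero _).hasDerivAt
  have h2 : HasFDerivAt (fun x : E => ‖x‖ ^ 2 * (R ^ 2)⁻¹) ((R ^ 2)⁻¹ • (2 • innerSL ℝ x)) x :=
    (hasStrictFDerivAt_norm_sq x).hasFDerivAt.mul_const _
  simp only [← div_eq_mul_inv] at h2
  have h3 := h1.comp_hasFDerivAt x h2
  have h4 : HasFDerivAt (ballCutoff R : E → ℝ) _ x := h3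
  rw [h4.fderiv]
  simp; ring

theorem tendsto_integral_ballCutoff_mul [MeasurableSpace E] [BorelSpace E] {μ : Measure E}
    {h : E → ℝ} (hh : Integrable h μ) :
    Tendsto (fun R => ∫ x, ballCutoff R x * h x ∂μ) atTop (𝓝 (∫ x, h x ∂μ)) := by
  refine tendsto_integral_filter_of_dominated_convergence (fun x => ‖h x‖) ?_ ?_ hh.norm ?_
  · exact .of_forall fun R =>
      (contDiff_ballCutoff R).continuous.measurable.aestronglyMeasurable.mul hh.1
  · refine .of_forall fun R => .of_forall fun x => ?_
    rw [norm_mul]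
    exact mul_le_of_le_one_left (norm_nonneg _) (abs_lineCutoff_le _)
  · refine .of_forall fun x => tendsto_const_nhds.congr' ?_
    filter_upwards [eventually_ge_atTop (‖x‖ + 1)] with R hR
    have : ‖x‖ ^ 2 / R ^ 2 ≤ 1 := by
      have h0 : 0 < R := by linarith [norm_nonneg x]
      rw [div_le_one (by positivity)]
      gcongr; linarith
    rw [ballCutoff, lineCutoff_of_le this, one_mul]

end Cutoff

/-! ### The divergence theorem on the whole space with vanishing flux. -/

section Divergence

variable {d : ℕ}

/-- Integration by parts against a radial cutoff. -/
theorem integral_ballCutoff_mul_div {G : Fin d → EuclideanSpace ℝ (Fin d) → ℝ}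
    (hG : ∀ j, ContDiff ℝ 1 (G j)) {R : ℝ} (hR : 0 < R) :
    ∫ x, ballCutoff R x * ∑ j, fderiv ℝ (G j) x (EuclideanSpace.single j 1)
      = -∫ x, deriv lineCutoff (‖x‖ ^ 2 / R ^ 2) * (2 / R ^ 2) * ∑ j, G j x * x j := by
  have hφ := contDiff_ballCutoff (E := EuclideanSpace ℝ (Fin d)) R
  have hφc := hφ.continuous
  have hφs := hasCompactSupport_ballCutoff (E := EuclideanSpace ℝ (Fin d)) hR
  have hφ' := hφ.continuous_fderiv one_ne_zero
  have i1 : ∀ j, Integrable fun x => fderiv ℝ (ballCutoff R) x (EuclideanSpace.single j 1) *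
      G j x := fun j =>
    (hφ'.clm_apply continuous_const |>.mul (hG j).continuous).integrable_of_hasCompactSupport
      ((hφs.fderiv_apply (𝕜 := ℝ) _).mul_right)
  have i2 : ∀ j, Integrable fun x => ballCutoff R x *
      fderiv ℝ (G j) x (EuclideanSpace.single j 1) := fun j =>
    (hφc.mul (((hG j).continuous_fderiv one_ne_zero).clm_apply
      continuous_const)).integrable_of_hasCompactSupport hφs.mul_right
  have i3 : ∀ j, Integrable fun x => ballCutoff R x * G j x := fun j =>
    (hφc.mul (hG j).continuous).integrable_of_hasCompactSupport hφs.mul_right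
  simp only [Finset.mul_sum]
  rw [integral_finsetSum _ fun j _ => i2 j, ← integral_neg]
  have : ∀ j, ∫ x, ballCutoff R x * fderiv ℝ (G j) x (EuclideanSpace.single j 1)
      = ∫ x, -(fderiv ℝ (ballCutoff R) x (EuclideanSpace.single j 1) * G j x) := fun j => by
    rw [integral_neg]
    exact integral_mul_fderiv_eq_neg_fderiv_mul_of_integrable (i1 j) (i2 j) (i3 j)
      (fun x _ => hφ.differentiable one_ne_zero x)
      (fun x _ => (hG j).differentiable one_ne_zero x)
  simp only [this]
  rw [← integral_finsetSum _ fun j _ => (i1 j).fun_neg]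
  refine integral_congr_ae (.of_forall fun x => ?_)
  simp only [Finset.sum_neg_distrib, neg_inj]
  refine Finset.sum_congr rfl fun j _ => ?_
  rw [fderiv_ballCutoff, EuclideanSpace.inner_single_right]
  simp; ring

/-- A `C¹` vector field whose flux through large spheres vanishes in the limit and whose divergence
is integrable has a divergence of integral zero. -/
theorem integral_div_eq_zero_of_tendsto_flux [NeZero d]
    {G : Fin d → EuclideanSpace ℝ (Fin d) → ℝ} (hG : ∀ j, ContDiff ℝ 1 (G j))
    (hint : Integrable fun x => ∑ j, fderiv ℝ (G j) x (EuclideanSpace.single j 1))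
    (hflux : Tendsto (fun R : ℝ => R ^ (d - 1) *
      ∫ θ : Metric.sphere (0 : EuclideanSpace ℝ (Fin d)) 1,
        ∑ j, G j (R • (θ : EuclideanSpace ℝ (Fin d))) * (θ : EuclideanSpace ℝ (Fin d)) j
        ∂(volume : Measure (EuclideanSpace ℝ (Fin d))).toSphere) atTop (𝓝 0)) :
    ∫ x, ∑ j, fderiv ℝ (G j) x (EuclideanSpace.single j 1) = 0 := by
  refine tendsto_nhds_unique (tendsto_integral_ballCutoff_mul hint) ?_
  set Φ : ℝ → ℝ := fun R : ℝ => R ^ (d - 1) *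
      ∫ θ : Metric.sphere (0 : EuclideanSpace ℝ (Fin d)) 1,
        ∑ j, G j (R • (θ : EuclideanSpace ℝ (Fin d))) * (θ : EuclideanSpace ℝ (Fin d)) j
        ∂(volume : Measure (EuclideanSpace ℝ (Fin d))).toSphere with hΦ
  have hχ' : Continuous (deriv lineCutoff) := contDiff_lineCutoff.continuous_deriv le_rfl
  -- The interval `[1, 4]` is the range of `r ^ 2 / R ^ 2` for `r` in `[R, 2R]`.
  obtain ⟨M, hM⟩ := (isCompact_Icc (a := (1 : ℝ)) (b := 4)).exists_bound_of_continuousOn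
    hχ'.continuousOn
  have hM0 : 0 ≤ M := (norm_nonneg _).trans (hM 1 (by simp))
  -- The cutoff is radial with gradient supported in the shell `R ≤ ‖x‖ ≤ 2R`, so polar coordinates
  -- turn the boundary term into a weighted average of the fluxes `Φ r`. The extra `r` comes from `x
  -- = r • θ`.
  have hpolar : ∀ R : ℝ, 0 < R →
      ∫ x : EuclideanSpace ℝ (Fin d),
        deriv lineCutoff (‖x‖ ^ 2 / R ^ 2) * (2 / R ^ 2) * ∑ j, G j x * x j
      = ∫ r in Icc R (2 * R), deriv lineCutoff (r ^ 2 / R ^ 2) * (2 / R ^ 2) * r * Φ r := by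
    intro R hR
    have hz : ∀ x : EuclideanSpace ℝ (Fin d), x ∉ Metric.closedBall 0 (2 * R) →
        deriv lineCutoff (‖x‖ ^ 2 / R ^ 2) * (2 / R ^ 2) * ∑ j, G j x * x j = 0 := by
      intro x hx
      have hx : 2 * R < ‖x‖ := by simpa using hx
      rw [deriv_lineCutoff_of_gt, zero_mul, zero_mul]
      rw [lt_div_iff₀ (by positivity)]
      nlinarith
    have hi : Integrable fun x : EuclideanSpace ℝ (Fin d) =>
        deriv lineCutoff (‖x‖ ^ 2 / R ^ 2) * (2 / R ^ 2) * ∑ j, G j x * x j := by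
      refine Continuous.integrable_of_hasCompactSupport ?_
        (HasCompactSupport.intro (isCompact_closedBall 0 (2 * R)) hz)
      have := fun j => (hG j).continuous
      fun_prop
    rw [integral_eq_integral_Ioi_integral_sphere volume hi, finrank_euclideanSpace_fin]
    rw [setIntegral_eq_of_subset_of_forall_sdiff_eq_zero (s := Icc R (2 * R)) measurableSet_Ioi
      (fun r hr => lt_of_lt_of_le hR hr.1)]
    · refine setIntegral_congr_fun measurableSet_Icc fun r hr => ?_
      have hr0 : 0 < r := lt_of_lt_of_le hR hr.1
      simp only [hΦ]
      have : ∀ θ : Metric.sphere (0 : EuclideanSpace ℝ (Fin d)) 1,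
          deriv lineCutoff (‖r • (θ : EuclideanSpace ℝ (Fin d))‖ ^ 2 / R ^ 2) * (2 / R ^ 2) *
            ∑ j, G j (r • (θ : EuclideanSpace ℝ (Fin d))) *
              (r • (θ : EuclideanSpace ℝ (Fin d))) j
          = (deriv lineCutoff (r ^ 2 / R ^ 2) * (2 / R ^ 2) * r) *
            ∑ j, G j (r • (θ : EuclideanSpace ℝ (Fin d))) *
              (θ : EuclideanSpace ℝ (Fin d)) j := by
        intro θ
        rw [norm_smul, Real.norm_of_nonneg hr0.le, norm_eq_of_mem_sphere, mul_one, Finset.mul_sum]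
        rw [Finset.mul_sum]
        refine Finset.sum_congr rfl fun j _ => ?_
        simp only [PiLp.smul_apply, smul_eq_mul]; ring
      simp only [this]
      rw [integral_const_mul]; ring
    · intro r hr
      have hr0 : 0 < r := hr.1
      have : ∀ θ : Metric.sphere (0 : EuclideanSpace ℝ (Fin d)) 1,
          deriv lineCutoff (‖r • (θ : EuclideanSpace ℝ (Fin d))‖ ^ 2 / R ^ 2) = 0 := by
        intro θ
        rw [norm_smul, Real.norm_of_nonneg hr0.le, norm_eq_of_mem_sphere, mul_one]
        rcases lt_or_ge r R with h | h
        · refine deriv_lineCutoff_of_lt ?_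
          rw [div_lt_one (by positivity)]
          gcongr
        · have h2 : 2 * R < r := by
            by_contra! h3
            exact hr.2 ⟨h, h3⟩
          refine deriv_lineCutoff_of_gt ?_
          rw [lt_div_iff₀ (by positivity)]
          nlinarith
      simp [this]
  rw [Metric.tendsto_atTop] at hflux ⊢
  intro ε hε
  -- The weight is at most `4 * M / R` on an interval of length `R`, so a flux bound `δ` yields `4 *
  -- M * δ`. The `+ 1` makes this strictly less than `ε` and covers `M = 0`.
  have hδ : 0 < ε / (4 * M + 1) := by positivity
  obtain ⟨R₀, hR₀⟩ := hflux _ hδ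
  refine ⟨max R₀ 1, fun R hR => ?_⟩
  have hRp : 0 < R := by linarith [le_max_right R₀ 1]
  rw [integral_ballCutoff_mul_div hG hRp, hpolar R hRp, dist_zero_right, norm_neg]
  have hb : ∀ r ∈ Icc R (2 * R),
      ‖deriv lineCutoff (r ^ 2 / R ^ 2) * (2 / R ^ 2) * r * Φ r‖
        ≤ 4 * M / R * (ε / (4 * M + 1)) := by
    intro r hr
    have hr0 : 0 < r := lt_of_lt_of_le hRp hr.1
    have h1 : ‖deriv lineCutoff (r ^ 2 / R ^ 2)‖ ≤ M := by
      refine hM _ ⟨?_, ?_⟩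
      · rw [one_le_div (by positivity)]; gcongr; exact hr.1
      · rw [div_le_iff₀ (by positivity)]; nlinarith [hr.1, hr.2]
    have h2 : ‖Φ r‖ ≤ ε / (4 * M + 1) := by
      have := hR₀ r ((le_max_left _ _).trans (hR.trans hr.1))
      rw [dist_zero_right] at this
      exact this.le
    have h3 : ‖2 / R ^ 2 * r‖ ≤ 4 / R := by
      rw [Real.norm_of_nonneg (by positivity), div_mul_eq_mul_div,
        div_le_div_iff₀ (by positivity) hRp]
      nlinarith [mul_le_mul_of_nonneg_right hr.2 hRp.le]
    rw [mul_assoc (deriv lineCutoff _), norm_mul, norm_mul]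
    calc _ ≤ M * (4 / R) * (ε / (4 * M + 1)) := by gcongr
      _ = _ := by ring
  have := norm_setIntegral_le_of_norm_le_const (μ := volume) (by simp) hb
  refine this.trans_lt ?_
  rw [measureReal_def, Real.volume_Icc, ENNReal.toReal_ofReal (by linarith)]
  have e : 4 * M / R * (ε / (4 * M + 1)) * (2 * R - R) = 4 * M * ε / (4 * M + 1) := by
    field_simp; ring
  rw [e, div_lt_iff₀ (by positivity)]
  nlinarith

end Divergence

/-! ### Partial derivatives of functions on `D ×ˢ univ`. -/

section Slices

variable {A E G : Type*} [NormedAddCommGroup A] [NormedSpace ℝ A]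
  [NormedAddCommGroup E] [NormedSpace ℝ E] [NormedAddCommGroup G] [NormedSpace ℝ G]
  {D : Set A} {f : A → E → G} {n : WithTop ℕ∞}

theorem contDiff_slice_right (hf : ContDiffOn ℝ n (fun z : A × E => f z.1 z.2) (D ×ˢ univ))
    {α : A} (hα : α ∈ D) : ContDiff ℝ n (f α) := by
  rw [← contDiffOn_univ]
  exact hf.comp (f := fun y => (α, y)) (by fun_prop) fun y _ => ⟨hα, mem_univ _⟩

theorem hasFDerivAt_slice_right
    (hf : ContDiffOn ℝ n (fun z : A × E => f z.1 z.2) (D ×ˢ univ)) (hn : n ≠ 0)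
    {α : A} (hα : α ∈ D) (x : E) :
    HasFDerivAt (f α) ((fderivWithin ℝ (fun z : A × E => f z.1 z.2) (D ×ˢ univ) (α, x)).comp
      (ContinuousLinearMap.inr ℝ A E)) x := by
  rw [← hasFDerivWithinAt_univ]
  have h := (hf.differentiableOn hn (α, x) ⟨hα, mem_univ _⟩).hasFDerivWithinAt
  exact h.comp x (hasFDerivAt_prodMk_right α x).hasFDerivWithinAt fun y _ => ⟨hα, mem_univ _⟩

theorem hasFDerivWithinAt_slice_left
    (hf : ContDiffOn ℝ n (fun z : A × E => f z.1 z.2) (D ×ˢ univ)) (hn : n ≠ 0)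
    {α : A} (hα : α ∈ D) (x : E) :
    HasFDerivWithinAt (f · x)
      ((fderivWithin ℝ (fun z : A × E => f z.1 z.2) (D ×ˢ univ) (α, x)).comp
      (ContinuousLinearMap.inl ℝ A E)) D α := by
  have h := (hf.differentiableOn hn (α, x) ⟨hα, mem_univ _⟩).hasFDerivWithinAt
  have h' : HasFDerivWithinAt (fun a : A => (a, x)) (ContinuousLinearMap.inl ℝ A E) D α :=
    (hasFDerivAt_prodMk_left α x).hasFDerivWithinAt
  have hm : MapsTo (fun a : A => (a, x)) D (D ×ˢ univ) := fun y hy => ⟨hy, mem_univ _⟩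
  exact HasFDerivWithinAt.comp (g := fun z : A × E => f z.1 z.2) α h h' hm

theorem contDiffOn_fderivWithin_slice_left (hu : UniqueDiffOn ℝ D) {m : WithTop ℕ∞}
    (hf : ContDiffOn ℝ n (fun z : A × E => f z.1 z.2) (D ×ˢ univ)) (hm : m + 1 ≤ n) :
    ContDiffOn ℝ m (fun z : A × E => fderivWithin ℝ (f · z.2) D z.1) (D ×ˢ univ) := by
  have hn : n ≠ 0 := by rintro rfl; simp at hm
  have h := hf.fderivWithin (hu.prod uniqueDiffOn_univ) hm
  refine (h.clm_comp (contDiffOn_const (c := ContinuousLinearMap.inl ℝ A E))).congr ?_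
  rintro ⟨α, x⟩ ⟨hα, -⟩
  exact (hasFDerivWithinAt_slice_left hf hn hα x).fderivWithin (hu α hα)

theorem continuousOn_fderiv_slice_right (hu : UniqueDiffOn ℝ D)
    (hf : ContDiffOn ℝ n (fun z : A × E => f z.1 z.2) (D ×ˢ univ)) (hn : 1 ≤ n) :
    ContinuousOn (fun z : A × E => fderiv ℝ (f z.1) z.2) (D ×ˢ univ) := by
  have hn' : n ≠ 0 := by rintro rfl; simp at hn
  have h := hf.continuousOn_fderivWithin (hu.prod uniqueDiffOn_univ) hn
  refine (h.clm_comp (continuousOn_const (c := ContinuousLinearMap.inr ℝ A E))).congr ?_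
  rintro ⟨α, x⟩ ⟨hα, -⟩
  exact (hasFDerivAt_slice_right hf hn' hα x).fderiv

end Slices

/-! ### Regularity of the free energy and the divergence form of the residual. -/

section FreeEnergy

variable {N d : ℕ} {D : Set (EuclideanSpace ℝ (Fin N))}
  {U : EuclideanSpace ℝ (Fin N) → EuclideanSpace ℝ (Fin d) → ℝ}

/-- The derivative in `α` of the Boltzmann factor `exp (-U α x)`. -/
noncomputable def boltzmannDeriv (D : Set (EuclideanSpace ℝ (Fin N)))
    (U : EuclideanSpace ℝ (Fin N) → EuclideanSpace ℝ (Fin d) → ℝ)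
    (α : EuclideanSpace ℝ (Fin N)) (x : EuclideanSpace ℝ (Fin d)) :
    EuclideanSpace ℝ (Fin N) →L[ℝ] ℝ :=
  fderivWithin ℝ (fun a => Real.exp (-U a x)) D α

theorem contDiffOn_boltzmann (hU : ContDiffOn ℝ 2
      (fun z : EuclideanSpace ℝ (Fin N) × EuclideanSpace ℝ (Fin d) => U z.1 z.2) (D ×ˢ univ)) :
    ContDiffOn ℝ 2 (fun z : EuclideanSpace ℝ (Fin N) × EuclideanSpace ℝ (Fin d) =>
      Real.exp (-U z.1 z.2)) (D ×ˢ univ) :=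
  hU.neg.exp

theorem contDiffOn_boltzmannDeriv (hu : UniqueDiffOn ℝ D) (hU : ContDiffOn ℝ 2
      (fun z : EuclideanSpace ℝ (Fin N) × EuclideanSpace ℝ (Fin d) => U z.1 z.2) (D ×ˢ univ)) :
    ContDiffOn ℝ 1 (fun z : EuclideanSpace ℝ (Fin N) × EuclideanSpace ℝ (Fin d) =>
      boltzmannDeriv D U z.1 z.2) (D ×ˢ univ) :=
  contDiffOn_fderivWithin_slice_left (f := fun a x => Real.exp (-U a x)) hu
    (contDiffOn_boltzmann hU) (by norm_num)

theorem integrable_boltzmannDeriv (hu : UniqueDiffOn ℝ D) (hU : ContDiffOn ℝ 2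
      (fun z : EuclideanSpace ℝ (Fin N) × EuclideanSpace ℝ (Fin d) => U z.1 z.2) (D ×ˢ univ))
    (hdom : LocallyDominated D U) {α : EuclideanSpace ℝ (Fin N)} (hα : α ∈ D) :
    Integrable (boltzmannDeriv D U α) := by
  obtain ⟨V, hV, g, hg, hb⟩ := hdom α hα
  refine hg.mono' (contDiff_slice_right (contDiffOn_boltzmannDeriv hu hU)
    hα).continuous.aestronglyMeasurable (.of_forall fun x => ?_)
  have := hb α ⟨mem_of_mem_nhds hV, hα⟩ x 1 (by simp)
  rwa [norm_iteratedFDerivWithin_one _ (hu α hα)] at this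

/-- Differentiation under the integral is applied twice: to the Boltzmann factor with the
first-order bound, then to its derivative with the second-order bound. -/
theorem partition_regularity (hD : LocConvex D) (hu : UniqueDiffOn ℝ D) (hU : ContDiffOn ℝ 2
      (fun z : EuclideanSpace ℝ (Fin N) × EuclideanSpace ℝ (Fin d) => U z.1 z.2) (D ×ˢ univ))
    (hint : ∀ α ∈ D, Integrable (fun x => Real.exp (-U α x))) (hdom : LocallyDominated D U) :
    (∀ α ∈ D, HasFDerivWithinAt (fun a => ∫ x, Real.exp (-U a x))
      (∫ x, boltzmannDeriv D U α x) D α) ∧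
    ContDiffOn ℝ 1 (fun a => ∫ x, Real.exp (-U a x)) D ∧
    ContDiffOn ℝ 1 (fun a => ∫ x, boltzmannDeriv D U a x) D := by
  have hb2 := contDiffOn_boltzmannDeriv hu hU
  have h1 := hD.contDiffOn_integral hu (μ := (volume : Measure (EuclideanSpace ℝ (Fin d))))
    (φ := fun a x => Real.exp (-U a x)) (φ' := boltzmannDeriv D U) hint
    (fun z hz => (integrable_boltzmannDeriv hu hU hdom hz).1)
    (fun z hz => by
      obtain ⟨V, hV, g, hg, hb⟩ := hdom z hz
      refine ⟨V, hV, g, hg, .of_forall fun x a ha => ?_⟩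
      have := hb a ha x 1 (by simp)
      rwa [norm_iteratedFDerivWithin_one _ (hu a ha.2)] at this)
    (.of_forall fun x z hz => (hasFDerivWithinAt_slice_left (f := fun a x => Real.exp (-U a x))
      (contDiffOn_boltzmann hU) two_ne_zero hz x).differentiableWithinAt.hasFDerivWithinAt)
    (.of_forall fun x => hb2.continuousOn.comp (f := fun a => (a, x)) (by fun_prop)
      fun a ha => ⟨ha, mem_univ _⟩)
  refine ⟨h1.1, h1.2, ?_⟩
  have hc2 := (contDiffOn_fderivWithin_slice_left (m := 0) hu hb2 (by simp)).continuousOn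
  refine (hD.contDiffOn_integral hu (μ := (volume : Measure (EuclideanSpace ℝ (Fin d))))
    (φ := boltzmannDeriv D U) (φ' := fun a x => fderivWithin ℝ (boltzmannDeriv D U · x) D a)
    (fun z hz => integrable_boltzmannDeriv hu hU hdom hz) ?_ ?_ ?_ ?_).2
  · intro z hz
    have : Continuous fun x => fderivWithin ℝ (boltzmannDeriv D U · x) D z := by
      rw [← continuousOn_univ]
      exact hc2.comp (f := fun x => (z, x)) (by fun_prop) fun x _ => ⟨hz, mem_univ _⟩
    exact this.aestronglyMeasurable
  · intro z hz
    obtain ⟨V, hV, g, hg, hb⟩ := hdom z hz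
    refine ⟨V, hV, g, hg, .of_forall fun x a ha => ?_⟩
    have := hb a ha x 2 (by simp)
    -- The second iterated derivative has the norm of the derivative of `boltzmannDeriv`, so the
    -- domination hypothesis applies.
    rwa [← one_add_one_eq_two, ← norm_iteratedFDerivWithin_fderivWithin hu ha.2,
      norm_iteratedFDerivWithin_one _ (hu a ha.2)] at this
  · exact .of_forall fun x z hz => (hasFDerivWithinAt_slice_left hb2 one_ne_zero hz
      x).differentiableWithinAt.hasFDerivWithinAt
  · exact .of_forall fun x => hc2.comp (f := fun a => (a, x)) (by fun_prop)
      fun a ha => ⟨ha, mem_univ _⟩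

theorem partition_pos {α : EuclideanSpace ℝ (Fin N)}
    (hint : Integrable (fun x => Real.exp (-U α x))) : 0 < ∫ x, Real.exp (-U α x) :=
  integral_exp_pos hint

theorem density_eq {α : EuclideanSpace ℝ (Fin N)}
    (hint : Integrable (fun x => Real.exp (-U α x))) (x : EuclideanSpace ℝ (Fin d)) :
    density U α x = (∫ y, Real.exp (-U α y))⁻¹ * Real.exp (-U α x) := by
  rw [density, freeEnergy, Real.exp_add, Real.exp_neg (Real.log _),
    Real.exp_log (partition_pos hint), mul_comm]

theorem freeEnergy_regularity (hD : LocConvex D) (hu : UniqueDiffOn ℝ D) (hU : ContDiffOn ℝ 2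
      (fun z : EuclideanSpace ℝ (Fin N) × EuclideanSpace ℝ (Fin d) => U z.1 z.2) (D ×ˢ univ))
    (hint : ∀ α ∈ D, Integrable (fun x => Real.exp (-U α x))) (hdom : LocallyDominated D U) :
    (∀ α ∈ D, HasFDerivWithinAt (freeEnergy U)
      (-((∫ x, Real.exp (-U α x))⁻¹ • ∫ x, boltzmannDeriv D U α x)) D α) ∧
    ContDiffOn ℝ 1 (freeEnergy U) D ∧ ContDiffOn ℝ 1 (fderivWithin ℝ (freeEnergy U) D) D := by
  obtain ⟨h1, h2, h3⟩ := partition_regularity hD hu hU hint hdom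
  have hne : ∀ α ∈ D, (∫ x, Real.exp (-U α x)) ≠ 0 := fun α hα => (partition_pos (hint α hα)).ne'
  have hd : ∀ α ∈ D, HasFDerivWithinAt (freeEnergy U)
      (-((∫ x, Real.exp (-U α x))⁻¹ • ∫ x, boltzmannDeriv D U α x)) D α :=
    fun α hα => ((h1 α hα).log (hne α hα)).neg
  refine ⟨hd, (h2.log hne).neg, ?_⟩
  refine ContDiffOn.congr (f := fun α =>
    -((∫ x, Real.exp (-U α x))⁻¹ • ∫ x, boltzmannDeriv D U α x)) ?_
    fun α hα => (hd α hα).fderivWithin (hu α hα)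
  exact ((h2.inv hne).smul h3).neg

theorem density_pos (α : EuclideanSpace ℝ (Fin N)) (x : EuclideanSpace ℝ (Fin d)) :
    0 < density U α x := Real.exp_pos _

theorem contDiffOn_density (hU : ContDiffOn ℝ 2
      (fun z : EuclideanSpace ℝ (Fin N) × EuclideanSpace ℝ (Fin d) => U z.1 z.2) (D ×ˢ univ))
    (hF : ContDiffOn ℝ 1 (freeEnergy U) D) :
    ContDiffOn ℝ 1 (fun z : EuclideanSpace ℝ (Fin N) × EuclideanSpace ℝ (Fin d) =>
      density U z.1 z.2) (D ×ˢ univ) := by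
  have h : ContDiffOn ℝ 1 (fun z : EuclideanSpace ℝ (Fin N) × EuclideanSpace ℝ (Fin d) =>
      freeEnergy U z.1) (D ×ˢ univ) := hF.comp contDiffOn_fst fun z hz => hz.1
  exact ((hU.of_le (by norm_num)).neg.add h).exp

/-- The right-hand side `ϱ (∇_α U - c)` of the divergence equation for `ϱ 𝓑`, in direction `v`. -/
noncomputable def source (D : Set (EuclideanSpace ℝ (Fin N)))
    (U : EuclideanSpace ℝ (Fin N) → EuclideanSpace ℝ (Fin d) → ℝ)
    (c : EuclideanSpace ℝ (Fin N) → EuclideanSpace ℝ (Fin N) →L[ℝ] ℝ)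
    (v : EuclideanSpace ℝ (Fin N)) (α : EuclideanSpace ℝ (Fin N))
    (x : EuclideanSpace ℝ (Fin d)) : ℝ :=
  density U α x * (fderivWithin ℝ (U · x) D α v - c α v)

/-- Domination controls derivatives of `exp (-U)`, not of `U`. This form expresses the source
through them, which makes its integrability and its integral accessible. -/
theorem source_eq (hu : UniqueDiffOn ℝ D) (hU : ContDiffOn ℝ 2
      (fun z : EuclideanSpace ℝ (Fin N) × EuclideanSpace ℝ (Fin d) => U z.1 z.2) (D ×ˢ univ))
    {α : EuclideanSpace ℝ (Fin N)} (hα : α ∈ D)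
    (hint : Integrable (fun x => Real.exp (-U α x)))
    (c : EuclideanSpace ℝ (Fin N) → EuclideanSpace ℝ (Fin N) →L[ℝ] ℝ)
    (v : EuclideanSpace ℝ (Fin N)) (x : EuclideanSpace ℝ (Fin d)) :
    source D U c v α x = -((∫ y, Real.exp (-U α y))⁻¹ * boltzmannDeriv D U α x v)
      - (∫ y, Real.exp (-U α y))⁻¹ * c α v * Real.exp (-U α x) := by
  have h := (hasFDerivWithinAt_slice_left hU two_ne_zero hα x).differentiableWithinAt
  have h2 : boltzmannDeriv D U α x = -(Real.exp (-U α x) • fderivWithin ℝ (U · x) D α) := by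
    have := h.hasFDerivWithinAt.neg.exp.fderivWithin (hu α hα)
    rw [boltzmannDeriv]
    simpa using this
  rw [source, density_eq hint, h2]
  simp; ring

theorem source_integral (hu : UniqueDiffOn ℝ D) (hU : ContDiffOn ℝ 2
      (fun z : EuclideanSpace ℝ (Fin N) × EuclideanSpace ℝ (Fin d) => U z.1 z.2) (D ×ˢ univ))
    (hdom : LocallyDominated D U) {α : EuclideanSpace ℝ (Fin N)} (hα : α ∈ D)
    (hint : Integrable (fun x => Real.exp (-U α x)))
    (c : EuclideanSpace ℝ (Fin N) → EuclideanSpace ℝ (Fin N) →L[ℝ] ℝ)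
    (v : EuclideanSpace ℝ (Fin N)) :
    Integrable (source D U c v α) ∧ ∫ x, source D U c v α x =
      -((∫ y, Real.exp (-U α y))⁻¹ • ∫ x, boltzmannDeriv D U α x) v - c α v := by
  have hb := integrable_boltzmannDeriv hu hU hdom hα
  have i1 := ((hb.apply_continuousLinearMap v).const_mul
    (∫ y, Real.exp (-U α y))⁻¹).fun_neg
  have i2 := hint.const_mul ((∫ y, Real.exp (-U α y))⁻¹ * c α v)
  have e : source D U c v α = fun x => -((∫ y, Real.exp (-U α y))⁻¹ * boltzmannDeriv D U α x v)
      - (∫ y, Real.exp (-U α y))⁻¹ * c α v * Real.exp (-U α x) :=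
    funext fun x => source_eq hu hU hα hint c v x
  rw [e]
  refine ⟨i1.sub i2, ?_⟩
  rw [integral_sub i1 i2, integral_neg, integral_const_mul, integral_const_mul]
  have := (partition_pos hint).ne'
  simp [ContinuousLinearMap.integral_apply hb]
  field_simp

theorem contDiffOn_source (hu : UniqueDiffOn ℝ D) (hU : ContDiffOn ℝ 2
      (fun z : EuclideanSpace ℝ (Fin N) × EuclideanSpace ℝ (Fin d) => U z.1 z.2) (D ×ˢ univ))
    (hF : ContDiffOn ℝ 1 (freeEnergy U) D)
    {c : EuclideanSpace ℝ (Fin N) → EuclideanSpace ℝ (Fin N) →L[ℝ] ℝ} (hc : ContDiffOn ℝ 1 c D)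
    (v : EuclideanSpace ℝ (Fin N)) :
    ContDiffOn ℝ 1 (fun z : EuclideanSpace ℝ (Fin N) × EuclideanSpace ℝ (Fin d) =>
      source D U c v z.1 z.2) (D ×ˢ univ) := by
  have h1 := contDiffOn_fderivWithin_slice_left (m := 1) hu hU (by norm_num)
  have h2 : ContDiffOn ℝ 1 (fun z : EuclideanSpace ℝ (Fin N) × EuclideanSpace ℝ (Fin d) =>
      c z.1) (D ×ˢ univ) := hc.comp contDiffOn_fst fun z hz => hz.1
  exact (contDiffOn_density hU hF).mul
    ((h1.clm_apply contDiffOn_const).sub (h2.clm_apply contDiffOn_const))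

theorem gradientWithin_apply {n : ℕ} (F : EuclideanSpace ℝ (Fin n) → ℝ)
    (s : Set (EuclideanSpace ℝ (Fin n))) (a : EuclideanSpace ℝ (Fin n)) (i : Fin n) :
    gradientWithin F s a i = fderivWithin ℝ F s a (EuclideanSpace.single i 1) := by
  have h := InnerProductSpace.toDual_symm_apply (𝕜 := ℝ) (x := EuclideanSpace.single i (1 : ℝ))
    (y := fderivWithin ℝ F s a)
  rw [← h, EuclideanSpace.inner_single_right]
  simp [gradientWithin]

theorem gradient_apply {n : ℕ} (F : EuclideanSpace ℝ (Fin n) → ℝ)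
    (a : EuclideanSpace ℝ (Fin n)) (i : Fin n) :
    gradient F a i = fderiv ℝ F a (EuclideanSpace.single i 1) := by
  rw [← gradientWithin_univ, gradientWithin_apply, fderivWithin_univ]

theorem residual_apply (B : EuclideanSpace ℝ (Fin N) → EuclideanSpace ℝ (Fin d) →
      Matrix (Fin N) (Fin d) ℝ) (F : EuclideanSpace ℝ (Fin N) → ℝ)
    (α : EuclideanSpace ℝ (Fin N)) (x : EuclideanSpace ℝ (Fin d)) (i : Fin N) :
    residual D U B F α x i =
      ∑ j, fderiv ℝ (fun y => B α y i j) x (EuclideanSpace.single j 1)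
      - ∑ j, B α x i j * fderiv ℝ (U α) x (EuclideanSpace.single j 1)
      - fderivWithin ℝ (U · x) D α (EuclideanSpace.single i 1)
      + fderivWithin ℝ F D α (EuclideanSpace.single i 1) := by
  simp [residual, rowDiv, Matrix.mulVec, dotProduct, gradient_apply, gradientWithin_apply]

/-- The residual times `ϱ` in divergence form. -/
theorem density_mul_residual {α : EuclideanSpace ℝ (Fin N)} (hU : ContDiff ℝ 2 (U α))
    {B : EuclideanSpace ℝ (Fin N) → EuclideanSpace ℝ (Fin d) → Matrix (Fin N) (Fin d) ℝ}
    {i : Fin N} (hB : ∀ j, ContDiff ℝ 1 fun y => B α y i j)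
    (F : EuclideanSpace ℝ (Fin N) → ℝ) (x : EuclideanSpace ℝ (Fin d)) :
    density U α x * residual D U B F α x i =
      ∑ j, fderiv ℝ (fun y => B α y i j * density U α y) x (EuclideanSpace.single j 1)
      - source D U (fderivWithin ℝ F D) (EuclideanSpace.single i 1) α x := by
  have hUd : HasFDerivAt (U α) (fderiv ℝ (U α) x) x :=
    (hU.differentiable two_ne_zero x).hasFDerivAt
  have hρ : HasFDerivAt (density U α) (density U α x • -fderiv ℝ (U α) x) x :=
    (hUd.neg.add_const (freeEnergy U α)).exp
  have h : ∀ j, fderiv ℝ (fun y => B α y i j * density U α y) x (EuclideanSpace.single j 1)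
      = density U α x * (fderiv ℝ (fun y => B α y i j) x (EuclideanSpace.single j 1)
        - B α x i j * fderiv ℝ (U α) x (EuclideanSpace.single j 1)) := fun j => by
    have h1 : HasFDerivAt (fun y => B α y i j) _ x :=
      ((hB j).differentiable one_ne_zero x).hasFDerivAt
    have h2 := (h1.mul hρ).fderiv
    rw [show (fun y => B α y i j * density U α y) = (fun y => B α y i j) * density U α from rfl, h2]
    simp; ring
  simp only [h, ← Finset.mul_sum, Finset.sum_sub_distrib]
  rw [residual_apply, source]
  ring

end FreeEnergy

/-! ### A radial solution with zero residual. -/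

section Existence

variable {N d : ℕ} {D : Set (EuclideanSpace ℝ (Fin N))}
  {U : EuclideanSpace ℝ (Fin N) → EuclideanSpace ℝ (Fin d) → ℝ}

/-- For the radial mean `m`, the product rule gives `d * m + x · ∇m`, which is the Euler identity
with `n = d - 1`. -/
theorem sum_fderiv_coord_mul_radialMean [NeZero d] {h : EuclideanSpace ℝ (Fin d) → ℝ}
    (hh : ContDiff ℝ 1 h) (x : EuclideanSpace ℝ (Fin d)) :
    ∑ j, fderiv ℝ (fun y : EuclideanSpace ℝ (Fin d) => y j * radialMean (d - 1) h y) x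
      (EuclideanSpace.single j 1) = h x := by
  have h1 := (hasFDerivAt_radialMean (d - 1) hh x).differentiableAt.hasFDerivAt
  have h2 : ∀ j, fderiv ℝ (fun y : EuclideanSpace ℝ (Fin d) => y j * radialMean (d - 1) h y) x
      (EuclideanSpace.single j 1)
      = radialMean (d - 1) h x
        + x j * fderiv ℝ (radialMean (d - 1) h) x (EuclideanSpace.single j 1) := fun j => by
    have h3 : HasFDerivAt (fun y : EuclideanSpace ℝ (Fin d) => y j)
      (EuclideanSpace.proj j : EuclideanSpace ℝ (Fin d) →L[ℝ] ℝ) x :=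
      (EuclideanSpace.proj j : EuclideanSpace ℝ (Fin d) →L[ℝ] ℝ).hasFDerivAt
    have h4 := (h3.mul h1).fderiv
    rw [show (fun y : EuclideanSpace ℝ (Fin d) => y j * radialMean (d - 1) h y)
      = (fun y : EuclideanSpace ℝ (Fin d) => y j) * radialMean (d - 1) h from rfl, h4]
    simp; ring
  have hd : ((d - 1 : ℕ) : ℝ) + 1 = d := by
    have := Nat.sub_add_cancel (Nat.one_le_iff_ne_zero.2 (NeZero.ne d))
    exact_mod_cast this
  have hx : x = ∑ j, x j • EuclideanSpace.single j (1 : ℝ) := by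
    ext i
    simp [Finset.sum_apply, Pi.single_apply]
  simp only [h2]
  rw [Finset.sum_add_distrib, ← radialMean_add_fderiv (d - 1) hh x, hd]
  congr 1
  · simp
  · conv_rhs => rw [hx, map_sum]
    rw [← hx]
    simp

/-- Settles `d = 0`: the space is a point of finite positive mass, and no field is available to
balance the source, so mean zero must already mean zero. -/
theorem eq_zero_of_integral_eq_zero_of_subsingleton [Subsingleton (EuclideanSpace ℝ (Fin d))]
    {h : EuclideanSpace ℝ (Fin d) → ℝ} (hh : ∫ x, h x = 0) (x : EuclideanSpace ℝ (Fin d)) :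
    h x = 0 := by
  have e : h = fun _ => h x := funext fun y => congrArg h (Subsingleton.elim y x)
  rw [e, integral_const, smul_eq_mul, mul_eq_zero] at hh
  refine hh.resolve_left fun h0 => ?_
  have hf : (volume : Measure (EuclideanSpace ℝ (Fin d))) univ ≠ ⊤ :=
    (Set.subsingleton_univ.finite.isCompact.measure_lt_top).ne
  rw [measureReal_def, ENNReal.toReal_eq_zero_iff] at h0
  exact (isOpen_univ.measure_ne_zero volume univ_nonempty) (h0.resolve_right hf)

/-- The solution of the divergence equation `∇ₓ · (ϱ 𝓑) = ϱ (∇_α 𝓤 - ∇_α 𝓕)` directed along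
rays from the origin. -/
noncomputable def radialField (D : Set (EuclideanSpace ℝ (Fin N)))
    (U : EuclideanSpace ℝ (Fin N) → EuclideanSpace ℝ (Fin d) → ℝ)
    (α : EuclideanSpace ℝ (Fin N)) (x : EuclideanSpace ℝ (Fin d)) : Matrix (Fin N) (Fin d) ℝ :=
  Matrix.of fun i j => (density U α x)⁻¹ * (x j * radialMean (d - 1)
    (source D U (fderivWithin ℝ (freeEnergy U) D) (EuclideanSpace.single i 1) α) x)

theorem radialField_mul_density (α : EuclideanSpace ℝ (Fin N)) (x : EuclideanSpace ℝ (Fin d))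
    (i : Fin N) (j : Fin d) :
    radialField D U α x i j * density U α x = x j * radialMean (d - 1)
      (source D U (fderivWithin ℝ (freeEnergy U) D) (EuclideanSpace.single i 1) α) x := by
  have := (density_pos (U := U) α x).ne'
  rw [radialField, Matrix.of_apply]
  field_simp

/-- The covector field `c` is free: `c = ∇𝓕` gives solvability, and `c = ∇F` identifies the gradient
of a minimizer. -/
theorem integral_source_freeEnergy (hD : LocConvex D) (hu : UniqueDiffOn ℝ D) (hU : ContDiffOn ℝ 2
      (fun z : EuclideanSpace ℝ (Fin N) × EuclideanSpace ℝ (Fin d) => U z.1 z.2) (D ×ˢ univ))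
    (hint : ∀ α ∈ D, Integrable (fun x => Real.exp (-U α x))) (hdom : LocallyDominated D U)
    {α : EuclideanSpace ℝ (Fin N)} (hα : α ∈ D)
    (c : EuclideanSpace ℝ (Fin N) → EuclideanSpace ℝ (Fin N) →L[ℝ] ℝ)
    (v : EuclideanSpace ℝ (Fin N)) :
    ∫ x, source D U c v α x = fderivWithin ℝ (freeEnergy U) D α v - c α v := by
  rw [(source_integral hu hU hdom hα (hint α hα) c v).2,
    ((freeEnergy_regularity hD hu hU hint hdom).1 α hα).fderivWithin (hu α hα)]
  rfl

theorem tendsto_sphereFlux_radialField (hD : LocConvex D) (hu : UniqueDiffOn ℝ D)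
    (hU : ContDiffOn ℝ 2
      (fun z : EuclideanSpace ℝ (Fin N) × EuclideanSpace ℝ (Fin d) => U z.1 z.2) (D ×ˢ univ))
    (hint : ∀ α ∈ D, Integrable (fun x => Real.exp (-U α x))) (hdom : LocallyDominated D U)
    {α : EuclideanSpace ℝ (Fin N)} (hα : α ∈ D) (i : Fin N) :
    Tendsto (sphereFlux U (radialField D U) α i) atTop (𝓝 0) := by
  rcases Nat.eq_zero_or_pos d with rfl | hd
  · refine tendsto_const_nhds.congr fun R => ?_
    simp [sphereFlux]
  have : NeZero d := ⟨hd.ne'⟩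
  set k := source D U (fderivWithin ℝ (freeEnergy U) D) (EuclideanSpace.single i 1) α with hk
  have hki : Integrable k := (source_integral hu hU hdom hα (hint α hα) _ _).1
  have h0 : ∫ x, k x = 0 := by
    rw [hk, integral_source_freeEnergy hD hu hU hint hdom hα, sub_self]
  rw [← h0]
  -- For `R ≥ 0` the flux is the integral of `k` over the ball of radius `R`, and these balls
  -- exhaust the space.
  refine Tendsto.congr' ?_ ((aecover_closedBall (x := (0 : EuclideanSpace ℝ (Fin d)))
    tendsto_id).integral_tendsto_of_countably_generated hki)
  filter_upwards [eventually_ge_atTop (0 : ℝ)] with R hR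
  have h1 := integral_sphere_radialMean volume hki hR
  rw [finrank_euclideanSpace_fin] at h1
  rw [id, ← h1, sphereFlux, ← integral_const_mul]
  refine integral_congr_ae (.of_forall fun θ => ?_)
  have hθ : ∑ j, (θ : EuclideanSpace ℝ (Fin d)) j ^ 2 = 1 := by
    rw [← EuclideanSpace.real_norm_sq_eq, norm_eq_of_mem_sphere, one_pow]
  simp only
  rw [Finset.sum_mul]
  have : ∀ j, radialField D U α (R • (θ : EuclideanSpace ℝ (Fin d))) i j *
      (θ : EuclideanSpace ℝ (Fin d)) j * density U α (R • (θ : EuclideanSpace ℝ (Fin d)))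
      = R * radialMean (d - 1) k (R • (θ : EuclideanSpace ℝ (Fin d))) *
        (θ : EuclideanSpace ℝ (Fin d)) j ^ 2 := fun j => by
    rw [mul_right_comm, radialField_mul_density, ← hk, PiLp.smul_apply, smul_eq_mul]
    ring
  simp only [this]
  rw [← Finset.mul_sum, hθ]
  ring

theorem radialField_mem_admissible (hD : LocConvex D) (hu : UniqueDiffOn ℝ D)
    (hU : ContDiffOn ℝ 2
      (fun z : EuclideanSpace ℝ (Fin N) × EuclideanSpace ℝ (Fin d) => U z.1 z.2) (D ×ˢ univ))
    (hint : ∀ α ∈ D, Integrable (fun x => Real.exp (-U α x))) (hdom : LocallyDominated D U) :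
    (radialField D U, freeEnergy U) ∈ Admissible D U := by
  obtain ⟨-, hF, hF'⟩ := freeEnergy_regularity hD hu hU hint hdom
  refine ⟨fun i j => ?_, hF, fun α hα i =>
    tendsto_sphereFlux_radialField hD hu hU hint hdom hα i⟩
  have h1 := contDiffOn_radialMean hD hu (d - 1)
    (contDiffOn_source hu hU hF hF' (EuclideanSpace.single i 1))
  have h2 := (contDiffOn_density hU hF).inv fun z _ => (density_pos z.1 z.2).ne'
  have h3 : ContDiffOn ℝ 1 (fun z : EuclideanSpace ℝ (Fin N) × EuclideanSpace ℝ (Fin d) =>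
      z.2 j) (D ×ˢ univ) :=
    ((EuclideanSpace.proj j : EuclideanSpace ℝ (Fin d) →L[ℝ] ℝ).contDiff.comp
      contDiff_snd).contDiffOn
  exact h2.mul (h3.mul h1)

theorem residual_radialField (hD : LocConvex D) (hu : UniqueDiffOn ℝ D)
    (hU : ContDiffOn ℝ 2
      (fun z : EuclideanSpace ℝ (Fin N) × EuclideanSpace ℝ (Fin d) => U z.1 z.2) (D ×ˢ univ))
    (hint : ∀ α ∈ D, Integrable (fun x => Real.exp (-U α x))) (hdom : LocallyDominated D U)
    {α : EuclideanSpace ℝ (Fin N)} (hα : α ∈ D) (x : EuclideanSpace ℝ (Fin d)) :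
    residual D U (radialField D U) (freeEnergy U) α x = 0 := by
  obtain ⟨-, hF, hF'⟩ := freeEnergy_regularity hD hu hU hint hdom
  have hadm := radialField_mem_admissible hD hu hU hint hdom
  ext i
  refine (mul_eq_zero.1 ?_).resolve_left (density_pos (U := U) α x).ne'
  have hB : ∀ j, ContDiff ℝ 1 fun y => radialField D U α y i j :=
    fun j => contDiff_slice_right (f := fun a y => radialField D U a y i j) (hadm.1 i j) hα
  rw [density_mul_residual (contDiff_slice_right hU hα) hB, sub_eq_zero]
  simp only [radialField_mul_density]
  rcases Nat.eq_zero_or_pos d with rfl | hd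
  · rw [Finset.univ_eq_empty, Finset.sum_empty, eq_comm]
    refine eq_zero_of_integral_eq_zero_of_subsingleton (h := source D U
      (fderivWithin ℝ (freeEnergy U) D) (EuclideanSpace.single i 1) α) ?_ x
    rw [integral_source_freeEnergy hD hu hU hint hdom hα, sub_self]
  · have : NeZero d := ⟨hd.ne'⟩
    exact sum_fderiv_coord_mul_radialMean
      (contDiff_slice_right (contDiffOn_source hu hU hF hF' _) hα) x

end Existence

/-! ### Minimizers recover the free energy up to a constant. -/

section Uniqueness

variable {N d : ℕ} {D : Set (EuclideanSpace ℝ (Fin N))}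
  {U : EuclideanSpace ℝ (Fin N) → EuclideanSpace ℝ (Fin d) → ℝ}

theorem fderivWithin_eq_of_residual_eq_zero (hD : LocConvex D) (hu : UniqueDiffOn ℝ D)
    (hU : ContDiffOn ℝ 2
      (fun z : EuclideanSpace ℝ (Fin N) × EuclideanSpace ℝ (Fin d) => U z.1 z.2) (D ×ˢ univ))
    (hint : ∀ α ∈ D, Integrable (fun x => Real.exp (-U α x))) (hdom : LocallyDominated D U)
    {B : EuclideanSpace ℝ (Fin N) → EuclideanSpace ℝ (Fin d) → Matrix (Fin N) (Fin d) ℝ}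
    {F : EuclideanSpace ℝ (Fin N) → ℝ} (hp : (B, F) ∈ Admissible D U)
    {α : EuclideanSpace ℝ (Fin N)} (hα : α ∈ D) (h0 : ∀ x, residual D U B F α x = 0) :
    fderivWithin ℝ F D α = fderivWithin ℝ (freeEnergy U) D α := by
  obtain ⟨hB, -, hflux⟩ := hp
  have key : ∀ i, fderivWithin ℝ (freeEnergy U) D α (EuclideanSpace.single i 1)
      - fderivWithin ℝ F D α (EuclideanSpace.single i 1) = 0 := by
    intro i
    set k := source D U (fderivWithin ℝ F D) (EuclideanSpace.single i 1) α with hk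
    have hki : Integrable k := (source_integral hu hU hdom hα (hint α hα) _ _).1
    rw [← integral_source_freeEnergy hD hu hU hint hdom hα, ← hk]
    have hBi : ∀ j, ContDiff ℝ 1 fun y => B α y i j :=
      fun j => contDiff_slice_right (f := fun a y => B a y i j) (hB i j) hα
    have hdiv : k = fun x => ∑ j, fderiv ℝ (fun y => B α y i j * density U α y) x
        (EuclideanSpace.single j 1) := funext fun x => by
      have := density_mul_residual (D := D) (contDiff_slice_right hU hα) hBi F x
      rw [h0 x, PiLp.zero_apply, mul_zero] at this
      linarith
    rcases Nat.eq_zero_or_pos d with rfl | hd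
    · rw [hdiv]; simp
    have : NeZero d := ⟨hd.ne'⟩
    -- Nothing is assumed about integrability of `𝓑 ϱ`; its divergence is integrable because it
    -- coincides with the source `k`.
    rw [hdiv] at hki ⊢
    have hρ : ContDiff ℝ 1 (density U α) := contDiff_slice_right
      (contDiffOn_density hU (freeEnergy_regularity hD hu hU hint hdom).2.1) hα
    refine integral_div_eq_zero_of_tendsto_flux (fun j => (hBi j).mul hρ) hki ?_
    refine (hflux α hα i).congr fun R => ?_
    rw [sphereFlux]
    congr 1
    refine integral_congr_ae (.of_forall fun θ => ?_)
    simp only [Finset.sum_mul]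
    exact Finset.sum_congr rfl fun j _ => mul_right_comm _ _ _
  refine ContinuousLinearMap.coe_injective
    ((EuclideanSpace.basisFun (Fin N) ℝ).toBasis.ext fun i => ?_)
  simpa using (sub_eq_zero.1 (key i)).symm

/-- On each convex trace the mean value inequality with constant `0` makes `F - G` constant. A
locally constant function on a connected space is constant. -/
theorem exists_eq_add_const_of_fderivWithin_eq (hD : LocConvex D) (hconn : IsConnected D) {F G : EuclideanSpace ℝ (Fin N) → ℝ}
    (hF : DifferentiableOn ℝ F D) (hG : DifferentiableOn ℝ G D)
    (h : ∀ α ∈ D, fderivWithin ℝ F D α = fderivWithin ℝ G D α) :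
    ∃ c : ℝ, ∀ α ∈ D, F α = G α + c := by
  obtain ⟨a, ha⟩ := hconn.nonempty
  have : PreconnectedSpace D := isPreconnected_iff_preconnectedSpace.1 hconn.isPreconnected
  have hloc : IsLocallyConstant fun z : D => F z - G z := by
    rw [IsLocallyConstant.iff_eventually_eq]
    rintro ⟨z, hz⟩
    obtain ⟨V, hV, hc⟩ := hD z hz
    have hd : ∀ y ∈ V ∩ D, HasFDerivWithinAt (fun y => F y - G y) (0 : _ →L[ℝ] ℝ) (V ∩ D) y := by
      intro y hy
      have := ((hF y hy.2).hasFDerivWithinAt.sub (hG y hy.2).hasFDerivWithinAt).mono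
        (inter_subset_right (s := V))
      rwa [h y hy.2, sub_self] at this
    have hs : ∀ w ∈ V ∩ D, F w - G w = F z - G z := fun w hw => by
      have := hc.norm_image_sub_le_of_norm_hasFDerivWithin_le (C := 0) hd (fun y _ => by simp)
        ⟨mem_of_mem_nhds hV, hz⟩ hw
      rw [zero_mul] at this
      exact sub_eq_zero.1 (norm_le_zero_iff.1 this)
    filter_upwards [continuous_subtype_val.continuousAt.preimage_mem_nhds hV] with w hw
    exact hs w ⟨hw, w.2⟩
  refine ⟨F a - G a, fun α hα => ?_⟩
  have := hloc.apply_eq_of_preconnectedSpace ⟨α, hα⟩ ⟨a, ha⟩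
  simp only at this
  linarith

theorem continuousOn_residual (hu : UniqueDiffOn ℝ D) (hU : ContDiffOn ℝ 2
      (fun z : EuclideanSpace ℝ (Fin N) × EuclideanSpace ℝ (Fin d) => U z.1 z.2) (D ×ˢ univ))
    {B : EuclideanSpace ℝ (Fin N) → EuclideanSpace ℝ (Fin d) → Matrix (Fin N) (Fin d) ℝ}
    {F : EuclideanSpace ℝ (Fin N) → ℝ} (hp : (B, F) ∈ Admissible D U) :
    ContinuousOn (fun z : EuclideanSpace ℝ (Fin N) × EuclideanSpace ℝ (Fin d) =>
      residual D U B F z.1 z.2) (D ×ˢ univ) := by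
  obtain ⟨hB, hF, -⟩ := hp
  have h : ∀ i, ContinuousOn (fun z : EuclideanSpace ℝ (Fin N) × EuclideanSpace ℝ (Fin d) =>
      residual D U B F z.1 z.2 i) (D ×ˢ univ) := by
    intro i
    simp only [residual_apply]
    have h1 := fun j => continuousOn_fderiv_slice_right (f := fun a y => B a y i j) hu (hB i j)
      le_rfl
    have h2 := continuousOn_fderiv_slice_right hu hU one_le_two
    have h3 := (contDiffOn_fderivWithin_slice_left (m := 0) hu hU (by norm_num)).continuousOn
    have h4 : ContinuousOn (fun z : EuclideanSpace ℝ (Fin N) × EuclideanSpace ℝ (Fin d) =>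
        fderivWithin ℝ F D z.1) (D ×ˢ univ) :=
      (hF.continuousOn_fderivWithin hu le_rfl).comp continuousOn_fst fun z hz => hz.1
    refine ((ContinuousOn.sub ?_ ?_).sub (h3.clm_apply continuousOn_const)).add
      (h4.clm_apply continuousOn_const)
    · exact continuousOn_finsetSum _ fun j _ => (h1 j).clm_apply continuousOn_const
    · exact continuousOn_finsetSum _ fun j _ =>
        (hB i j).continuousOn.mul (h2.clm_apply continuousOn_const)
  exact (PiLp.continuous_toLp 2 _).comp_continuousOn (continuousOn_pi.2 h)

/-- A loss equal to zero forces a continuous residual to vanish identically. -/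
theorem residual_eq_zero_of_pinnLoss_eq_zero (hDm : MeasurableSet D)
    {q : EuclideanSpace ℝ (Fin N) → EuclideanSpace ℝ (Fin d) → ℝ}
    (hq_meas : Measurable (Function.uncurry q)) (hq_pos : ∀ α ∈ D, ∀ x, 0 < q α x)
    {f : EuclideanSpace ℝ (Fin N) → ℝ} (hf_meas : Measurable f)
    (hf_supp : ∀ α ∈ D, ∀ V ∈ 𝓝 α, 0 < ∫⁻ a in V ∩ D, ENNReal.ofReal (f a))
    {B : EuclideanSpace ℝ (Fin N) → EuclideanSpace ℝ (Fin d) → Matrix (Fin N) (Fin d) ℝ}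
    {F : EuclideanSpace ℝ (Fin N) → ℝ}
    (hres : ContinuousOn (fun z : EuclideanSpace ℝ (Fin N) × EuclideanSpace ℝ (Fin d) =>
      residual D U B F z.1 z.2) (D ×ˢ univ)) (h0 : pinnLoss D U q f B F = 0)
    {α : EuclideanSpace ℝ (Fin N)} (hα : α ∈ D) (x : EuclideanSpace ℝ (Fin d)) :
    residual D U B F α x = 0 := by
  by_contra hne
  set c : ℝ := ‖residual D U B F α x‖ / 2 with hc
  have hc0 : 0 < c := by have := norm_pos_iff.2 hne; positivity
  have hev := (hres (α, x) ⟨hα, mem_univ _⟩).norm.eventually_const_lt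
    (u := c) (by rw [hc]; exact half_lt_self (norm_pos_iff.2 hne))
  rw [eventually_nhdsWithin_iff] at hev
  obtain ⟨r, hr, hball⟩ := Metric.eventually_nhds_iff_ball.1 hev
  simp only [← ball_prod_same] at hball
  set V := Metric.ball α r
  set S := Metric.ball x r
  have hVm : MeasurableSet V := Metric.isOpen_ball.measurableSet
  have hSm : MeasurableSet S := Metric.isOpen_ball.measurableSet
  set Q : EuclideanSpace ℝ (Fin N) → ENNReal := fun a => ∫⁻ y in S, ENNReal.ofReal (q a y) with hQ
  have hqm : Measurable (Function.uncurry fun a y => ENNReal.ofReal (q a y)) := hq_meas.ennreal_ofReal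
  have hqa : ∀ a, Measurable fun y => ENNReal.ofReal (q a y) :=
    fun a => hqm.comp measurable_prodMk_left
  have hQm : Measurable Q := hqm.lintegral_prod_right
  have hQ0 : ∀ a ∈ D, Q a ≠ 0 := by
    intro a ha hQa
    rw [hQ] at hQa
    replace hQa := (lintegral_eq_zero_iff (hqa a)).1 hQa
    have hμ : (volume.restrict S) ≠ 0 := by
      rw [Ne, Measure.restrict_eq_zero]
      exact (Metric.measure_ball_pos volume x hr).ne'
    have : NeBot (ae (volume.restrict S)) := ae_neBot.2 hμ
    obtain ⟨y, hy⟩ := hQa.exists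
    exact absurd (ENNReal.ofReal_eq_zero.1 hy) (not_le.2 (hq_pos a ha y))
  -- On `V ∩ D` times `S` the residual exceeds `c`, so the loss dominates this integral. As `Q` is
  -- nonzero on `D`, `f` would have no mass on `V ∩ D`, against full support.
  have hle : ∫⁻ a in V ∩ D, ENNReal.ofReal (c ^ 2) * (ENNReal.ofReal (f a) * Q a) ≤ 0 := by
    rw [← h0, pinnLoss]
    refine le_trans ?_ (lintegral_mono_set (inter_subset_right (s := V)))
    refine setLIntegral_mono' (hVm.inter hDm) fun a ha => ?_
    simp only [hQ]
    rw [← mul_assoc, ← lintegral_const_mul _ (hqa a)]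
    refine le_trans ?_ (setLIntegral_le_lintegral S _)
    refine setLIntegral_mono' hSm fun y hy => ?_
    have hcy : c < ‖residual D U B F a y‖ := hball (a, y) ⟨ha.1, hy⟩ ⟨ha.2, mem_univ _⟩
    have hqy := (hq_pos a ha.2 y).le
    rw [ENNReal.ofReal_mul (by positivity), ENNReal.ofReal_mul (by positivity),
      mul_right_comm]
    gcongr
  have hae := (lintegral_eq_zero_iff
    ((hf_meas.ennreal_ofReal.mul hQm).const_mul _)).1 (le_antisymm hle zero_le)
  refine (hf_supp α hα V (Metric.ball_mem_nhds _ hr)).ne' ?_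
  rw [lintegral_eq_zero_iff hf_meas.ennreal_ofReal]
  filter_upwards [hae, ae_restrict_mem (hVm.inter hDm)] with a ha haD
  have hc2 : ENNReal.ofReal (c ^ 2) ≠ 0 := by
    rw [Ne, ENNReal.ofReal_eq_zero, not_le]; positivity
  exact ((mul_eq_zero.1 ((mul_eq_zero.1 ha).resolve_left hc2)).resolve_right (hQ0 a haD.2))

end Uniqueness

end MultimarginalPINN

open MultimarginalPINN in
theorem mainTheorem10 {N d : ℕ}
    (D : Set (EuclideanSpace ℝ (Fin N)))
    (hD_meas : MeasurableSet D)
    (hD_conn : IsConnected D)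
    (hD_int : D ⊆ closure (interior D))
    (hD_loc : ∀ α ∈ D, ∃ V ∈ 𝓝 α, Convex ℝ (V ∩ D))
    (U : EuclideanSpace ℝ (Fin N) → EuclideanSpace ℝ (Fin d) → ℝ)
    (hU : ContDiffOn ℝ 2
      (fun z : EuclideanSpace ℝ (Fin N) × EuclideanSpace ℝ (Fin d) => U z.1 z.2) (D ×ˢ univ))
    (hU_int : ∀ α ∈ D, Integrable (fun x => Real.exp (-U α x)))
    (hU_dom : MultimarginalPINN.LocallyDominated D U)
    (q : EuclideanSpace ℝ (Fin N) → EuclideanSpace ℝ (Fin d) → ℝ)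
    (hq_meas : Measurable (Function.uncurry q))
    (hq_pos : ∀ α ∈ D, ∀ x, 0 < q α x)
    (hq_pdf : ∀ α ∈ D, ∫⁻ x, ENNReal.ofReal (q α x) = 1)
    (f : EuclideanSpace ℝ (Fin N) → ℝ)
    (hf_meas : Measurable f)
    (hf_nonneg : ∀ α ∈ D, 0 ≤ f α)
    (hf_pdf : ∫⁻ α in D, ENNReal.ofReal (f α) = 1)
    (hf_supp : ∀ α ∈ D, ∀ V ∈ 𝓝 α, 0 < ∫⁻ a in V ∩ D, ENNReal.ofReal (f a)) :
    IsLeast ((fun p => MultimarginalPINN.pinnLoss D U q f p.1 p.2) ''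
        MultimarginalPINN.Admissible D U) 0 ∧
    ∀ p ∈ MultimarginalPINN.Admissible D U,
      IsMinOn (fun p => MultimarginalPINN.pinnLoss D U q f p.1 p.2)
          (MultimarginalPINN.Admissible D U) p →
        (∀ α ∈ D, ∀ x, MultimarginalPINN.residual D U p.1 p.2 α x = 0) ∧
        (∀ α ∈ D, ∀ x,
          MultimarginalPINN.residual D U p.1 (MultimarginalPINN.freeEnergy U) α x = 0) ∧
        (∃ c : ℝ, ∀ α ∈ D, p.2 α = MultimarginalPINN.freeEnergy U α + c) ∧
        (∀ α₀ ∈ D, p.2 α₀ = MultimarginalPINN.freeEnergy U α₀ →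
          ∀ α ∈ D, p.2 α = MultimarginalPINN.freeEnergy U α) := by
  have hD : LocConvex D := hD_loc
  have hu : UniqueDiffOn ℝ D := hD.uniqueDiffOn hD_int
  have hadm : (radialField D U, freeEnergy U) ∈ Admissible D U :=
    radialField_mem_admissible hD hu hU hU_int hU_dom
  have hzero : pinnLoss D U q f (radialField D U) (freeEnergy U) = 0 := by
    rw [pinnLoss, setLIntegral_congr_fun (g := fun _ => 0) hD_meas fun α hα => ?_, lintegral_zero]
    simp [residual_radialField hD hu hU hU_int hU_dom hα]
  refine ⟨⟨⟨_, hadm, hzero⟩, fun _ _ => zero_le⟩, ?_⟩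
  rintro ⟨B, F⟩ hp hmin
  have h0 : pinnLoss D U q f B F = 0 :=
    le_antisymm ((isMinOn_iff.1 hmin _ hadm).trans_eq hzero) zero_le
  have hres : ∀ α ∈ D, ∀ x, residual D U B F α x = 0 := fun α hα x =>
    residual_eq_zero_of_pinnLoss_eq_zero hD_meas hq_meas hq_pos hf_meas hf_supp
      (continuousOn_residual hu hU hp) h0 hα x
  have hgrad : ∀ α ∈ D, fderivWithin ℝ F D α = fderivWithin ℝ (freeEnergy U) D α :=
    fun α hα => fderivWithin_eq_of_residual_eq_zero hD hu hU hU_int hU_dom hp hα (hres α hα)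
  obtain ⟨c, hc⟩ := exists_eq_add_const_of_fderivWithin_eq hD hD_conn
    (hp.2.1.differentiableOn one_ne_zero)
    ((freeEnergy_regularity hD hu hU hU_int hU_dom).2.1.differentiableOn one_ne_zero) hgrad
  refine ⟨hres, fun α hα x => ?_, ⟨c, hc⟩, fun α₀ hα₀ h α hα => ?_⟩
  -- The residual sees `F` only through its gradient, which agrees with that of the free energy.
  · rw [← hres α hα x]
    ext i
    rw [residual_apply, residual_apply, hgrad α hα]
  · have h1 : F α₀ = freeEnergy U α₀ := h
    have h2 := hc α₀ hα₀
    have h3 := hc α hα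
    simp only at h3 ⊢
    linarith
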